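/- Let $q\in\mathbb C^\times$ not be a root of unity, and put $[n]_q=(q^n-q^{-n})/(q-q^{-1})$. Let $\mathcal U_q=\mathcal U_q(\mathfrak{sl}_2)$ be the algebra generated by $e,f,k^{\pm1}$ with $kk^{-1}=1=k^{-1}k$, $kek^{-1}=q^2e$, $kfk^{-1}=q^{-2}f$, $ef-fe=(k-k^{-1})/(q-q^{-1})$, with comultiplication $\Delta(e)=e\otimes k+1\otimes e$, $\Delta(f)=f\otimes1+k^{-1}\otimes f$, $\Delta(k^{\pm1})=k^{\pm1}\otimes k^{\pm1}$. For $\lambda\in\mathbb C^\times$ let $L_q(\lambda)$ be the irreducible quotient of $\mathcal U_q/\mathcal U_q(f,k-\lambda)$ (irreducible module of lowest weight $\lambda$). For $m\in\frac12\mathbb Z$ write $L_q(m)=L_q(q^m)$ (only $m\in\mathbb Z$ is needed for this parameter) and $L_{q^2}(m)=L_{q^2}(q^{2m})$, so that the chosen square root of $q^2$ is $q$. On $\mathbb C[x_1,x_2]$ let $\mu_j$ be multiplication by $x_j$, $\gamma_j^{\pm1}x^\alpha=q^{\pm\alpha_j}x^\alpha$ and $\partial_{j,q^2}x^\alpha=[\alpha_j]_{q^2}x^{\alpha-\varepsilon_j}$;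 on $\mathbb S=\mathbb C[y]$ let $\nu$ be multiplication by $y$, $\omega^{\pm1}y^c=q^{\pm c}y^c$, $\nabla y^c=[c]_qy^{c-1}$. Let $\mathcal P(\mathbb S)=\mathbb C[x_1,x_2]\otimes\mathbb S$. The algebra $\mathcal U_{q^2}$ acts on $\mathcal P(\mathbb S)$ by $\sigma_\Delta=(\sigma_w\otimes\sigma_s)\circ\Delta$, where $$\sigma_w(k)=\gamma_1^2\gamma_2^{-2},\quad \sigma_w(e)=\mu_1\partial_{2,q^2},\quad \sigma_w(f)=\mu_2\partial_{1,q^2},$$ $$\sigma_s(k)=q\omega^2,\quad \sigma_s(e)=\tfrac1{[2]_q}\nu^2,\quad \sigma_s(f)=-\tfrac1{[2]_q}\nabla^2,$$ and $\mathcal U_q$ acts by $\sigma$, where $$\sigma(k)=q^2\gamma_1^2\gamma_2^2,\quad \sigma(e)=E=[2]_q\left(q^2\gamma_2^2\omega\mu_1\nabla+\mu_2\nu\right),\quad \sigma(f)=F=\partial_{1,q^2}\nu-\gamma_1^{-2}\omega\,\partial_{2,q^2}\nabla .$$ Let $\mathcal P(\mathbb S)^d$ be the part of degree $d$ in $x_1,x_2$,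 let $\mathcal M^d=\ker F\cap\mathcal P(\mathbb S)^d$, and let $\mathcal M^d_+$ and $\mathcal M^d_-$ be the subspaces of the elements of $\mathcal M^d$ that are even, respectively odd, in $y$. Then the actions $\sigma_\Delta$ and $\sigma$ commute, and under the joint action of $(\mathcal U_{q^2},\mathcal U_q)$ there is an isomorphism $$\mathcal P(\mathbb S)\cong\bigoplus_{d\ge0}\left(L_{q^2}(\tfrac12-d)\oplus L_{q^2}(\tfrac32+d)\right)\otimes L_q(2d+2),$$ under which the $d$-th summand corresponds to $\sum_{k\ge0}E^k(\mathcal M^d)$. The decomposition is multiplicity-free: the modules $L_{q^2}(\frac12-d)\otimes L_q(2d+2)$ and $L_{q^2}(\frac32+d)\otimes L_q(2d+2)$, $d\ge0$, are irreducible over $\mathcal U_{q^2}\otimes\mathcal U_q$ and pairwise non-isomorphic. The decomposition is displayed by the following triangle (the columns are the $\mathcal P(\mathbb S)^d$): $$\begin{array}{ccccccc} \mathcal P(\mathbb S)^0&&\mathcal P(\mathbb S)^1&&\mathcal P(\mathbb S)^2&&\cdots\\ \mathcal M^0&\xrightarrow{E}&E(\mathcal M^0)&\xrightarrow{E}&E^2(\mathcal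 M^0)&\xrightarrow{E}&\cdots\\ &&\mathcal M^1&\xrightarrow{E}&E(\mathcal M^1)&\xrightarrow{E}&\cdots\\ &&&&\mathcal M^2&\xrightarrow{E}&\cdots \end{array}$$ That is, $\mathcal P(\mathbb S)=\bigoplus_{d\ge0}\mathcal P(\mathbb S)^d$; $\mathcal P(\mathbb S)^d=\bigoplus_{k=0}^dE^k(\mathcal M^{d-k})$ for every $d\ge0$; $E$ maps $E^k(\mathcal M^d)$ bijectively onto $E^{k+1}(\mathcal M^d)$ for all $d,k\ge0$; and $\mathcal M^d=\mathcal M^d_+\oplus\mathcal M^d_-$ with $\mathcal M^d_+\cong L_{q^2}(\frac12-d)$ and $\mathcal M^d_-\cong L_{q^2}(\frac32+d)$ as $\mathcal U_{q^2}$-modules. -/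

import Mathlib

open scoped TensorProduct DirectSum

namespace QMetaplectic

noncomputable section

/-- `q` is a nonzero complex number which is not a root of unity. -/
structure IsGeneric (q : ℂ) : Prop where
  ne_zero : q ≠ 0
  pow_ne_one : ∀ n : ℕ, 0 < n → q ^ n ≠ 1

/-- The quantum integer `[n]_q = (q ^ n - q ^ (-n)) / (q - q ^ (-1))`. -/
def qInt (q : ℂ) (n : ℕ) : ℂ := (q ^ n - q⁻¹ ^ n) / (q - q⁻¹)

/-! ### The quantized enveloping algebra of `sl₂` -/

/-- The four generators `e, f, k, k⁻¹`. -/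
inductive Gen
  | e | f | k | kinv

/-- The defining relations of `U_q(sl₂)`. -/
inductive UqRel (q : ℂ) : FreeAlgebra ℂ Gen → FreeAlgebra ℂ Gen → Prop
  | k_mul_kinv : UqRel q (.ι ℂ .k * .ι ℂ .kinv) 1
  | kinv_mul_k : UqRel q (.ι ℂ .kinv * .ι ℂ .k) 1
  | k_e : UqRel q (.ι ℂ .k * .ι ℂ .e * .ι ℂ .kinv) (q ^ 2 • .ι ℂ .e)
  | k_f : UqRel q (.ι ℂ .k * .ι ℂ .f * .ι ℂ .kinv) ((q ^ 2)⁻¹ • .ι ℂ .f)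
  | e_f : UqRel q (.ι ℂ .e * .ι ℂ .f - .ι ℂ .f * .ι ℂ .e)
      ((q - q⁻¹)⁻¹ • (.ι ℂ .k - .ι ℂ .kinv))

/-- The algebra `U_q(sl₂)`, by generators and relations. -/
def Uq (q : ℂ) : Type := RingQuot (UqRel q)

instance (q : ℂ) : Ring (Uq q) := inferInstanceAs (Ring (RingQuot (UqRel q)))

instance (q : ℂ) : Algebra ℂ (Uq q) := inferInstanceAs (Algebra ℂ (RingQuot (UqRel q)))

namespace Uq

/-- The quotient map from the free algebra. -/
def mk (q : ℂ) : FreeAlgebra ℂ Gen →ₐ[ℂ] Uq q := RingQuot.mkAlgHom ℂ (UqRel q)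

/-- The class of a generator in `U_q(sl₂)`. -/
def gen (q : ℂ) (g : Gen) : Uq q := mk q (FreeAlgebra.ι ℂ g)

/-- The generator `e`. -/
abbrev e (q : ℂ) : Uq q := gen q .e
/-- The generator `f`. -/
abbrev f (q : ℂ) : Uq q := gen q .f
/-- The generator `k`. -/
abbrev k (q : ℂ) : Uq q := gen q .k
/-- The generator `k⁻¹`. -/
abbrev kinv (q : ℂ) : Uq q := gen q .kinv

theorem mk_rel {q : ℂ} {x y : FreeAlgebra ℂ Gen} (h : UqRel q x y) : mk q x = mk q y :=
  RingQuot.mkAlgHom_rel ℂ h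

theorem k_mul_kinv (q : ℂ) : k q * kinv q = 1 := by
  simpa [gen] using mk_rel (UqRel.k_mul_kinv (q := q))

theorem kinv_mul_k (q : ℂ) : kinv q * k q = 1 := by
  simpa [gen] using mk_rel (UqRel.kinv_mul_k (q := q))

theorem k_e (q : ℂ) : k q * e q * kinv q = q ^ 2 • e q := by
  simpa [gen] using mk_rel (UqRel.k_e (q := q))

theorem k_f (q : ℂ) : k q * f q * kinv q = (q ^ 2)⁻¹ • f q := by
  simpa [gen] using mk_rel (UqRel.k_f (q := q))

theorem e_f (q : ℂ) : e q * f q - f q * e q = (q - q⁻¹)⁻¹ • (k q - kinv q) := by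
  simpa [gen] using mk_rel (UqRel.e_f (q := q))

section lift
variable {A : Type*} [Ring A] [Algebra ℂ A]

/-- The universal property: elements `E, F, K, K'` of an algebra that satisfy the defining
relations determine a homomorphism from `U_q(sl₂)`. -/
def lift (q : ℂ) (E F K K' : A) (h₁ : K * K' = 1) (h₂ : K' * K = 1)
    (h₃ : K * E * K' = q ^ 2 • E) (h₄ : K * F * K' = (q ^ 2)⁻¹ • F)
    (h₅ : E * F - F * E = (q - q⁻¹)⁻¹ • (K - K')) : Uq q →ₐ[ℂ] A :=
  RingQuot.liftAlgHom ℂ (s := UqRel q)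
    ⟨FreeAlgebra.lift ℂ fun g => match g with
        | .e => E
        | .f => F
        | .k => K
        | .kinv => K',
      by intro x y h; cases h <;> simpa⟩

end lift

/-- The comultiplication, `Δ(e) = e ⊗ k + 1 ⊗ e`, `Δ(f) = f ⊗ 1 + k⁻¹ ⊗ f`, `Δ(k) = k ⊗ k`. -/
def comul (q : ℂ) (hq : q ≠ 0) : Uq q →ₐ[ℂ] Uq q ⊗[ℂ] Uq q :=
  lift q (e q ⊗ₜ k q + 1 ⊗ₜ e q) (f q ⊗ₜ 1 + kinv q ⊗ₜ f q) (k q ⊗ₜ k q) (kinv q ⊗ₜ kinv q)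
    (by simp [k_mul_kinv, Algebra.TensorProduct.one_def])
    (by simp [kinv_mul_k, Algebra.TensorProduct.one_def])
    (by
      have h : k q * k q * kinv q = k q := by rw [mul_assoc, k_mul_kinv, mul_one]
      simp only [mul_add, add_mul, Algebra.TensorProduct.tmul_mul_tmul, k_e, mul_one, k_mul_kinv,
        h, smul_add, TensorProduct.smul_tmul', TensorProduct.tmul_smul])
    (by
      simp only [mul_add, add_mul, Algebra.TensorProduct.tmul_mul_tmul, k_f, mul_one, k_mul_kinv,
        one_mul, smul_add, TensorProduct.smul_tmul', TensorProduct.tmul_smul])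
    (by
      have h1 : k q * f q = (q ^ 2)⁻¹ • (f q * k q) := by
        rw [← smul_mul_assoc, ← k_f, mul_assoc, kinv_mul_k, mul_one]
      have h2 : e q * kinv q = q ^ 2 • (kinv q * e q) := by
        rw [← mul_smul_comm, ← k_e, ← mul_assoc, ← mul_assoc, kinv_mul_k, one_mul]
      have h3 := e_f q
      rw [sub_eq_iff_eq_add] at h3
      have hq2 : q ^ 2 ≠ 0 := pow_ne_zero 2 hq
      simp only [mul_add, add_mul, Algebra.TensorProduct.tmul_mul_tmul, mul_one, one_mul, h1, h2,
        h3, TensorProduct.add_tmul, TensorProduct.tmul_add, TensorProduct.smul_tmul',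
        TensorProduct.tmul_smul, TensorProduct.sub_tmul, TensorProduct.tmul_sub, smul_smul,
        inv_mul_cancel₀ hq2, one_smul, smul_sub]
      abel)

end Uq

/-! ### Lowest weight modules -/

/-- The universal lowest weight module `M_q(lam)`: the quotient of `U_q(sl₂)` by the left ideal
generated by `f` and `k - lam`. -/
abbrev Verma (q lam : ℂ) : Type :=
  Uq q ⧸ Submodule.span (Uq q) {Uq.f q, Uq.k q - algebraMap ℂ (Uq q) lam}

/-- The irreducible lowest weight module `L_q(lam)`: the quotient of `M_q(lam)` by its largest
proper submodule, i.e. by the sum of all proper submodules. -/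
def L (q lam : ℂ) : Type :=
  Verma q lam ⧸ sSup {N : Submodule (Uq q) (Verma q lam) | N ≠ ⊤}

instance (q lam : ℂ) : AddCommGroup (L q lam) :=
  inferInstanceAs (AddCommGroup (Verma q lam ⧸ sSup {N : Submodule (Uq q) (Verma q lam) | N ≠ ⊤}))

instance (q lam : ℂ) : Module (Uq q) (L q lam) :=
  inferInstanceAs (Module (Uq q) (Verma q lam ⧸ sSup {N : Submodule (Uq q) (Verma q lam) | N ≠ ⊤}))

instance (q lam : ℂ) : Module ℂ (L q lam) :=
  inferInstanceAs (Module ℂ (Verma q lam ⧸ sSup {N : Submodule (Uq q) (Verma q lam) | N ≠ ⊤}))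

instance (q lam : ℂ) : IsScalarTower ℂ (Uq q) (L q lam) :=
  inferInstanceAs (IsScalarTower ℂ (Uq q)
    (Verma q lam ⧸ sSup {N : Submodule (Uq q) (Verma q lam) | N ≠ ⊤}))

/-! ### The operators of the quantized Weyl algebra on polynomials -/

/-- `P N = ℂ[x₁, …, x_N]`. -/
abbrev P (N : ℕ) : Type := MvPolynomial (Fin N) ℂ

/-- Multiplication `μ_j` by the variable `x_j`. -/
def mu {N : ℕ} (j : Fin N) : Module.End ℂ (P N) := LinearMap.mulLeft ℂ (MvPolynomial.X j)

/-- The degree operator `x^α ↦ q ^ (α_j) x^α`. For the parameter `q` it is `γ_j`, for the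
parameter `q⁻¹` it is `γ_j⁻¹`. -/
def gam {N : ℕ} (q : ℂ) (j : Fin N) : Module.End ℂ (P N) :=
  (MvPolynomial.basisMonomials (Fin N) ℂ).constr ℂ fun α =>
    q ^ α j • MvPolynomial.monomial α 1

/-- The partial `q`-derivative `∂_{j,q} : x^α ↦ [α_j]_q x^(α - ε_j)`. -/
def der {N : ℕ} (q : ℂ) (j : Fin N) : Module.End ℂ (P N) :=
  (MvPolynomial.basisMonomials (Fin N) ℂ).constr ℂ fun α =>
    qInt q (α j) • MvPolynomial.monomial (α - Finsupp.single j 1) 1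


theorem mu_monomial {N : ℕ} (j : Fin N) (α : Fin N →₀ ℕ) :
    mu j (MvPolynomial.monomial α 1) = MvPolynomial.monomial (α + Finsupp.single j 1) 1 := by
  simp [mu, MvPolynomial.X, MvPolynomial.monomial_mul, add_comm]

theorem gam_monomial {N : ℕ} (q : ℂ) (j : Fin N) (α : Fin N →₀ ℕ) :
    gam q j (MvPolynomial.monomial α 1) = q ^ α j • MvPolynomial.monomial α 1 := by
  have := (MvPolynomial.basisMonomials (Fin N) ℂ).constr_basis ℂ (fun α =>
    q ^ α j • (MvPolynomial.monomial α 1 : P N)) α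
  simpa [gam] using this

theorem der_monomial {N : ℕ} (q : ℂ) (j : Fin N) (α : Fin N →₀ ℕ) :
    der q j (MvPolynomial.monomial α 1) =
      qInt q (α j) • MvPolynomial.monomial (α - Finsupp.single j 1) 1 := by
  have := (MvPolynomial.basisMonomials (Fin N) ℂ).constr_basis ℂ (fun α =>
    qInt q (α j) • (MvPolynomial.monomial (α - Finsupp.single j 1) 1 : P N)) α
  simpa [der] using this

theorem end_ext {N : ℕ} {M : Type*} [AddCommMonoid M] [Module ℂ M] {A B : P N →ₗ[ℂ] M}
    (h : ∀ α, A (MvPolynomial.monomial α 1) = B (MvPolynomial.monomial α 1)) : A = B :=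
  (MvPolynomial.basisMonomials (Fin N) ℂ).ext fun α => by simpa using h α

theorem gam_mul_gam {N : ℕ} (a b : ℂ) (j : Fin N) : gam a j * gam b j = gam (a * b) j :=
  end_ext fun α => by simp [gam_monomial, smul_smul, mul_pow, mul_comm]

theorem gam_one {N : ℕ} (j : Fin N) : gam 1 j = 1 :=
  end_ext fun α => by simp [gam_monomial]

theorem gam_comm {N : ℕ} (a b : ℂ) (i j : Fin N) : Commute (gam a i) (gam b j) :=
  end_ext fun α => by simp [gam_monomial, smul_smul, mul_comm]

theorem gam_pow {N : ℕ} (a : ℂ) (j : Fin N) (n : ℕ) : gam a j ^ n = gam (a ^ n) j := by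
  induction n with
  | zero => simp [gam_one]
  | succ n ih => rw [pow_succ, ih, gam_mul_gam, pow_succ]

theorem gam_mu {N : ℕ} (a : ℂ) (i j : Fin N) :
    gam a i * mu j = (if i = j then a else 1) • (mu j * gam a i) :=
  end_ext fun α => by
    by_cases h : i = j
    · subst h
      simp [gam_monomial, mu_monomial, smul_smul, pow_succ, mul_comm]
    · simp [gam_monomial, mu_monomial, h]

theorem gam_der {N : ℕ} {a : ℂ} (ha : a ≠ 0) (c : ℂ) (i j : Fin N) :
    gam a i * der c j = (if i = j then a⁻¹ else 1) • (der c j * gam a i) :=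
  end_ext fun α => by
    by_cases h : i = j
    · subst h
      rcases Nat.eq_zero_or_pos (α i) with h0 | h0
      · simp [gam_monomial, der_monomial, h0, qInt]
      · obtain ⟨n, hn⟩ := Nat.exists_eq_succ_of_ne_zero h0.ne'
        simp [gam_monomial, der_monomial, smul_smul, hn, pow_succ]
        field_simp
    · simp [gam_monomial, der_monomial, h, smul_smul, mul_comm]

theorem mu_der {N : ℕ} (c : ℂ) (j : Fin N) (α : Fin N →₀ ℕ) :
    (mu j * der c j) (MvPolynomial.monomial α 1) =
      qInt c (α j) • MvPolynomial.monomial α 1 := by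
  rcases Nat.eq_zero_or_pos (α j) with h0 | h0
  · simp [der_monomial, h0, qInt]
  · have : α - Finsupp.single j 1 + Finsupp.single j 1 = α :=
      tsub_add_cancel_of_le (by simpa [Nat.one_le_iff_ne_zero, Nat.pos_iff_ne_zero] using h0)
    simp [der_monomial, mu_monomial, this]

theorem der_mu {N : ℕ} (c : ℂ) (j : Fin N) (α : Fin N →₀ ℕ) :
    (der c j * mu j) (MvPolynomial.monomial α 1) =
      qInt c (α j + 1) • MvPolynomial.monomial α 1 := by
  simp [der_monomial, mu_monomial]

theorem mu_comm {N : ℕ} (i j : Fin N) : Commute (mu i) (mu j) :=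
  end_ext fun α => by simp [mu_monomial, add_right_comm]

theorem der_comm_mu {N : ℕ} (c : ℂ) {i j : Fin N} (h : i ≠ j) : Commute (der c i) (mu j) :=
  end_ext fun α => by
    rcases Nat.eq_zero_or_pos (α i) with h0 | h0
    · simp [mu_monomial, der_monomial, h.symm, h0, qInt]
    · have : α + Finsupp.single j 1 - Finsupp.single i 1
          = α - Finsupp.single i 1 + Finsupp.single j 1 :=
        tsub_add_eq_add_tsub (by simpa [Nat.one_le_iff_ne_zero, Nat.pos_iff_ne_zero] using h0) |>.symm
      simp [mu_monomial, der_monomial, h.symm, this]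

theorem der_comm {N : ℕ} (c d : ℂ) {i j : Fin N} (h : i ≠ j) : Commute (der c i) (der d j) :=
  end_ext fun α => by
    simp [der_monomial, h.symm, h, smul_smul, mul_comm, tsub_right_comm]

theorem musq_dersq {N : ℕ} (c : ℂ) (j : Fin N) (α : Fin N →₀ ℕ) :
    (mu j ^ 2 * der c j ^ 2) (MvPolynomial.monomial α 1) =
      (qInt c (α j) * qInt c (α j - 1)) • MvPolynomial.monomial α 1 := by
  by_cases h : 2 ≤ α j
  · have : α - Finsupp.single j 1 - Finsupp.single j 1 + Finsupp.single j 1 + Finsupp.single j 1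
        = α := by
      ext i
      by_cases hi : j = i
      · subst hi
        simp
        omega
      · simp [hi]
    simp [pow_two, der_monomial, mu_monomial, smul_smul, this]
  · have : qInt c (α j) * qInt c (α j - 1) = 0 := by
      have : α j = 0 ∨ α j = 1 := by omega
      rcases this with h | h <;> simp [h, qInt]
    simp only [pow_two, Module.End.mul_apply, der_monomial, map_smul, smul_smul]
    simp [this]

theorem dersq_musq {N : ℕ} (c : ℂ) (j : Fin N) (α : Fin N →₀ ℕ) :
    (der c j ^ 2 * mu j ^ 2) (MvPolynomial.monomial α 1) =
      (qInt c (α j + 2) * qInt c (α j + 1)) • MvPolynomial.monomial α 1 := by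
  simp [pow_two, der_monomial, mu_monomial, smul_smul]

section weights
variable {A : Type*} [Ring A] [Algebra ℂ A] {K K' X Y : A} {c d : ℂ}

theorem wt_mul (h : K * X = c • (X * K)) (h' : K * Y = d • (Y * K)) :
    K * (X * Y) = (c * d) • (X * Y * K) := by
  rw [← mul_assoc, h, smul_mul_assoc, mul_assoc, h', mul_smul_comm, smul_smul, mul_assoc]

theorem wt_mul_left (h : K * X = c • (X * K)) (h' : K' * X = d • (X * K')) :
    (K * K') * X = (c * d) • (X * (K * K')) := by
  rw [mul_assoc, h', mul_smul_comm, ← mul_assoc, h, smul_mul_assoc, smul_smul, mul_assoc,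
    mul_comm d]

theorem wt_sub (h : K * X = c • (X * K)) (h' : K * Y = c • (Y * K)) :
    K * (X - Y) = c • ((X - Y) * K) := by
  rw [mul_sub, h, h', ← smul_sub, sub_mul]

theorem comm_expand {X' Y' : A} (h : X * Y' = Y' * X) (h' : Y * X' = X' * Y) :
    (c • (d • X + Y)) * (X' - Y') - (X' - Y') * (c • (d • X + Y)) =
      c • (d • (X * X' - X' * X) - (Y * Y' - Y' * Y)) := by
  simp only [smul_mul_assoc, mul_smul_comm, ← smul_sub, add_mul, mul_add, mul_sub, sub_mul, h, h']
  congr 1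
  simp only [smul_sub]
  abel

theorem scalar_expand {V : Type*} [AddCommGroup V] [Module ℂ V] {t s a b c d r k l : ℂ} {x : V}
    (h : t * (s * (a - b) - (c - d)) = r * (k - l)) :
    t • (s • (a • x - b • x) - (c • x - d • x)) = r • (k • x - l • x) := by
  simp only [← sub_smul, smul_smul, h]

theorem wt_conj (h : K * X = c • (X * K)) (hK : K * K' = 1) (hc : c = d) :
    K * X * K' = d • X := by
  rw [h, smul_mul_assoc, mul_assoc, hK, mul_one, hc]

end weights

theorem IsGeneric.sub_inv_ne_zero {q : ℂ} (hq : IsGeneric q) : q - q⁻¹ ≠ 0 := by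
  intro h
  have h0 := hq.ne_zero
  apply hq.pow_ne_one 2 two_pos
  field_simp at h
  linear_combination h

theorem IsGeneric.sq {q : ℂ} (hq : IsGeneric q) : IsGeneric (q ^ 2) where
  ne_zero := pow_ne_zero 2 hq.ne_zero
  pow_ne_one n hn := by
    rw [← pow_mul]
    exact hq.pow_ne_one _ (by omega)

theorem gam_conj {N : ℕ} {a : ℂ} (ha : a ≠ 0) (j : Fin N) : gam a j * gam a⁻¹ j = 1 := by
  rw [gam_mul_gam, mul_inv_cancel₀ ha, gam_one]

/-! ### The representations -/

/-- `K_w = γ₁² γ₂⁻²`. -/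
def Kw (q : ℂ) : Module.End ℂ (P 2) := gam q 0 ^ 2 * gam q⁻¹ 1 ^ 2
/-- `K_w⁻¹ = γ₁⁻² γ₂²`. -/
def KwInv (q : ℂ) : Module.End ℂ (P 2) := gam q⁻¹ 0 ^ 2 * gam q 1 ^ 2
/-- `E_w = μ₁ ∂_{2,q²}`. -/
def Ew (q : ℂ) : Module.End ℂ (P 2) := mu 0 * der (q ^ 2) 1
/-- `F_w = μ₂ ∂_{1,q²}`. -/
def Fw (q : ℂ) : Module.End ℂ (P 2) := mu 1 * der (q ^ 2) 0

theorem Kw_mul_KwInv {q : ℂ} (hq : q ≠ 0) : Kw q * KwInv q = 1 :=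
  end_ext fun α => by
    simp only [Kw, KwInv, gam_pow, Module.End.mul_apply, gam_monomial, map_smul, smul_smul,
      Module.End.one_apply]
    rw [show ∀ x : P 2, ∀ c : ℂ, c = 1 → c • x = x from fun x c h => by rw [h, one_smul]]
    simp only [← pow_mul, inv_pow]
    field_simp

theorem KwInv_mul_Kw {q : ℂ} (hq : q ≠ 0) : KwInv q * Kw q = 1 := by
  rw [← Kw_mul_KwInv hq]
  exact end_ext fun α => by
    simp [Kw, KwInv, gam_pow, gam_monomial, smul_smul, mul_comm, mul_left_comm]

/-- The representation `σ_w` of `U_{q²}(sl₂)` on `ℂ[x₁, x₂]`. -/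
def sigmaW (q : ℂ) (hq : IsGeneric q) : Uq (q ^ 2) →ₐ[ℂ] Module.End ℂ (P 2) :=
  Uq.lift (q ^ 2) (Ew q) (Fw q) (Kw q) (KwInv q)
    (Kw_mul_KwInv hq.ne_zero) (KwInv_mul_Kw hq.ne_zero)
    (wt_conj (wt_mul
        (wt_mul_left (by rw [gam_pow]; exact gam_mu _ _ _) (by rw [gam_pow]; exact gam_mu _ _ _))
        (wt_mul_left (by rw [gam_pow]; exact gam_der (pow_ne_zero _ hq.ne_zero) _ _ _)
          (by rw [gam_pow]; exact gam_der (pow_ne_zero _ (inv_ne_zero hq.ne_zero)) _ _ _)))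
      (Kw_mul_KwInv hq.ne_zero) (by simp; ring))
    (wt_conj (wt_mul
        (wt_mul_left (by rw [gam_pow]; exact gam_mu _ _ _) (by rw [gam_pow]; exact gam_mu _ _ _))
        (wt_mul_left (by rw [gam_pow]; exact gam_der (pow_ne_zero _ hq.ne_zero) _ _ _)
          (by rw [gam_pow]; exact gam_der (pow_ne_zero _ (inv_ne_zero hq.ne_zero)) _ _ _)))
      (Kw_mul_KwInv hq.ne_zero) (by simp; ring))
    (by
      have h1 : Ew q * Fw q = (mu 0 * der (q ^ 2) 0) * (der (q ^ 2) 1 * mu 1) := by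
        have a := (der_comm_mu (N := 2) (q ^ 2) (i := 0) (j := 1) (by decide)).eq
        have b := (der_comm (N := 2) (q ^ 2) (q ^ 2) (i := 0) (j := 1) (by decide)).eq
        simp only [Ew, Fw, mul_assoc]
        rw [← a, ← mul_assoc (der _ 1), ← b]
        simp only [mul_assoc]
      have h2 : Fw q * Ew q = (mu 1 * der (q ^ 2) 1) * (der (q ^ 2) 0 * mu 0) := by
        have a := (der_comm_mu (N := 2) (q ^ 2) (i := 1) (j := 0) (by decide)).eq
        have b := (der_comm (N := 2) (q ^ 2) (q ^ 2) (i := 1) (j := 0) (by decide)).eq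
        simp only [Ew, Fw, mul_assoc]
        rw [← a, ← mul_assoc (der _ 0), ← b]
        simp only [mul_assoc]
      refine end_ext fun α => ?_
      rw [h1, h2, LinearMap.sub_apply, Module.End.mul_apply, der_mu, map_smul, mu_der,
        Module.End.mul_apply (mu 1 * _), der_mu, map_smul, mu_der]
      simp only [Kw, KwInv, gam_pow, LinearMap.smul_apply, LinearMap.sub_apply,
        Module.End.mul_apply, gam_monomial, map_smul, smul_smul, ← sub_smul, smul_sub]
      congr 1
      have h0 := hq.ne_zero
      have hs := hq.sq.sub_inv_ne_zero
      have ht : q ^ 4 - 1 ≠ 0 := sub_ne_zero.2 (hq.pow_ne_one 4 (by norm_num))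
      simp only [qInt, inv_pow, pow_succ (q ^ 2) (α _)]
      field_simp
      ring)

/-- `K_s = q ω²`. -/
def Ks (q : ℂ) : Module.End ℂ (P 1) := q • gam q 0 ^ 2
/-- `K_s⁻¹ = q⁻¹ ω⁻²`. -/
def KsInv (q : ℂ) : Module.End ℂ (P 1) := q⁻¹ • gam q⁻¹ 0 ^ 2
/-- `E_s = ν² / [2]_q`. -/
def Es (q : ℂ) : Module.End ℂ (P 1) := (qInt q 2)⁻¹ • mu 0 ^ 2
/-- `F_s = -∇² / [2]_q`. -/
def Fs (q : ℂ) : Module.End ℂ (P 1) := -(qInt q 2)⁻¹ • der q 0 ^ 2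

theorem qInt_two {q : ℂ} (hq : IsGeneric q) : qInt q 2 = q + q⁻¹ := by
  rw [qInt, div_eq_iff hq.sub_inv_ne_zero]
  ring

theorem Ks_mul_KsInv {q : ℂ} (h0 : q ≠ 0) : Ks q * KsInv q = 1 := by
  simp [Ks, KsInv, gam_pow, gam_mul_gam, smul_smul, h0, gam_one]

theorem KsInv_mul_Ks {q : ℂ} (h0 : q ≠ 0) : KsInv q * Ks q = 1 := by
  simp [Ks, KsInv, gam_pow, gam_mul_gam, smul_smul, h0, gam_one]

/-- The `q`-oscillator representation `σ_s` of `U_{q²}(sl₂)` on `ℂ[y]`. -/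
def sigmaS (q : ℂ) (hq : IsGeneric q) : Uq (q ^ 2) →ₐ[ℂ] Module.End ℂ (P 1) :=
  Uq.lift (q ^ 2) (Es q) (Fs q) (Ks q) (KsInv q)
    (Ks_mul_KsInv hq.ne_zero) (KsInv_mul_Ks hq.ne_zero)
    (by
      rw [Ks, Es, gam_pow]
      refine wt_conj (c := q ^ 2 * q ^ 2) ?_ ?_ (by ring)
      · have h := gam_mu (q ^ 2) (0 : Fin 1) 0
        rw [if_pos rfl] at h
        have h' := wt_mul h h
        simp only [pow_two (mu 0), smul_mul_assoc, mul_smul_comm, h', smul_smul]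
        congr 1
        ring
      · rw [← gam_pow]
        exact Ks_mul_KsInv hq.ne_zero)
    (by
      rw [Ks, Fs, gam_pow]
      refine wt_conj (c := (q ^ 2)⁻¹ * (q ^ 2)⁻¹) ?_ ?_ (by rw [← mul_inv, ← pow_two])
      · have h := gam_der (pow_ne_zero 2 hq.ne_zero) q (0 : Fin 1) 0
        rw [if_pos rfl] at h
        have h' := wt_mul h h
        simp only [pow_two (der q 0), smul_mul_assoc, mul_smul_comm, h', smul_smul]
        congr 1
        ring
      · rw [← gam_pow]
        exact Ks_mul_KsInv hq.ne_zero)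
    (by
      refine end_ext fun α => ?_
      have h1 : Es q * Fs q = ((qInt q 2)⁻¹ * -(qInt q 2)⁻¹) • (mu 0 ^ 2 * der q 0 ^ 2) := by
        rw [Es, Fs, smul_mul_smul_comm]
      have h2 : Fs q * Es q = (-(qInt q 2)⁻¹ * (qInt q 2)⁻¹) • (der q 0 ^ 2 * mu 0 ^ 2) := by
        rw [Es, Fs, smul_mul_smul_comm]
      rw [h1, h2, LinearMap.sub_apply, LinearMap.smul_apply, LinearMap.smul_apply, musq_dersq,
        dersq_musq, qInt_two hq]
      simp only [Ks, KsInv, gam_pow, LinearMap.smul_apply, LinearMap.sub_apply,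
        gam_monomial, smul_smul, ← sub_smul]
      congr 1
      have h0 := hq.ne_zero
      have hs := hq.sub_inv_ne_zero
      have hs2 : q ^ 2 - 1 ≠ 0 := sub_ne_zero.2 (hq.pow_ne_one 2 (by norm_num))
      have ht : q ^ 4 - 1 ≠ 0 := sub_ne_zero.2 (hq.pow_ne_one 4 (by norm_num))
      have hu : q ^ 2 + 1 ≠ 0 := fun h => ht (by linear_combination (q ^ 2 - 1) * h)
      rcases α 0 with _ | n
      · simp only [qInt, inv_pow, zero_add, pow_zero, pow_one]
        field_simp
        ring
      · rw [Nat.add_sub_cancel]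
        simp only [qInt, inv_pow, pow_succ, pow_zero, mul_pow]
        field_simp
        ring)

/-! ### The space of polynomial symplectic spinors -/

/-- `P(S) = ℂ[x₁, x₂] ⊗ ℂ[y]`. -/
abbrev PS : Type := P 2 ⊗[ℂ] P 1

/-- The diagonal representation `σ_Δ` of `U_{q²}(sl₂)` on `P(S)`. -/
def sigmaDelta (q : ℂ) (hq : IsGeneric q) : Uq (q ^ 2) →ₐ[ℂ] Module.End ℂ PS :=
  ((Module.endTensorEndAlgHom (R := ℂ) (S := ℂ) (A := ℂ)).comp
    (Algebra.TensorProduct.map (sigmaW q hq) (sigmaS q hq))).comp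
      (Uq.comul (q ^ 2) (pow_ne_zero 2 hq.ne_zero))

/-- `K = q² γ₁² γ₂²`. -/
def opK (q : ℂ) : Module.End ℂ PS := q ^ 2 • TensorProduct.map (gam q 0 ^ 2 * gam q 1 ^ 2) 1
/-- `K⁻¹ = q⁻² γ₁⁻² γ₂⁻²`. -/
def opKInv (q : ℂ) : Module.End ℂ PS :=
  (q ^ 2)⁻¹ • TensorProduct.map (gam q⁻¹ 0 ^ 2 * gam q⁻¹ 1 ^ 2) 1
/-- `E = [2]_q (q² γ₂² ω μ₁ ∇ + μ₂ ν)`. -/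
def opE (q : ℂ) : Module.End ℂ PS :=
  qInt q 2 • (q ^ 2 • TensorProduct.map (gam q 1 ^ 2 * mu 0) (gam q 0 * der q 0)
    + TensorProduct.map (mu 1) (mu 0))
/-- The `q`-symplectic Dirac operator `F = ∂_{1,q²} ν - γ₁⁻² ω ∂_{2,q²} ∇`. -/
def opF (q : ℂ) : Module.End ℂ PS :=
  TensorProduct.map (der (q ^ 2) 0) (mu 0)
    - TensorProduct.map (gam q⁻¹ 0 ^ 2 * der (q ^ 2) 1) (gam q 0 * der q 0)

theorem ps_ext {A B : Module.End ℂ PS}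
    (h : ∀ α β, A (MvPolynomial.monomial α 1 ⊗ₜ MvPolynomial.monomial β 1) =
      B (MvPolynomial.monomial α 1 ⊗ₜ MvPolynomial.monomial β 1)) : A = B :=
  TensorProduct.ext (end_ext fun α => end_ext fun β => h α β)

theorem opK_apply (q : ℂ) (α : Fin 2 →₀ ℕ) (z : P 1) :
    opK q (MvPolynomial.monomial α 1 ⊗ₜ z) =
      (q ^ (2 + 2 * α 0 + 2 * α 1)) • (MvPolynomial.monomial α 1 ⊗ₜ z) := by
  simp only [opK, gam_pow, LinearMap.smul_apply, TensorProduct.map_tmul, Module.End.mul_apply,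
    gam_monomial, map_smul, smul_smul, Module.End.one_apply, TensorProduct.smul_tmul']
  congr 2
  ring

theorem opKInv_apply (q : ℂ) (α : Fin 2 →₀ ℕ) (z : P 1) :
    opKInv q (MvPolynomial.monomial α 1 ⊗ₜ z) =
      (q ^ (2 + 2 * α 0 + 2 * α 1))⁻¹ • (MvPolynomial.monomial α 1 ⊗ₜ z) := by
  simp only [opKInv, gam_pow, LinearMap.smul_apply, TensorProduct.map_tmul, Module.End.mul_apply,
    gam_monomial, map_smul, smul_smul, Module.End.one_apply, TensorProduct.smul_tmul']
  congr 2
  simp only [inv_pow, ← mul_inv, ← pow_mul, ← pow_add]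
  congr 2
  ring

theorem opK_mul_opKInv {q : ℂ} (hq : q ≠ 0) : opK q * opKInv q = 1 :=
  ps_ext fun α β => by
    simp [opK_apply, opKInv_apply, smul_smul, hq]

theorem opKInv_mul_opK {q : ℂ} (hq : q ≠ 0) : opKInv q * opK q = 1 :=
  ps_ext fun α β => by
    simp [opK_apply, opKInv_apply, smul_smul, hq]

theorem wt_map {G A : Module.End ℂ (P 2)} {c : ℂ} (h : G * A = c • (A * G)) (r : ℂ)
    (B : Module.End ℂ (P 1)) :
    (r • TensorProduct.map G 1) * TensorProduct.map A B =
      c • (TensorProduct.map A B * (r • TensorProduct.map G 1)) := by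
  simp only [smul_mul_assoc, mul_smul_comm, ← TensorProduct.map_mul, h, one_mul, mul_one,
    TensorProduct.map_smul_left]
  rw [smul_comm]

theorem opK_opE {q : ℂ} : opK q * opE q = q ^ 2 • (opE q * opK q) := by
  have key : ∀ j : Fin 2, (gam q 0 ^ 2 * gam q 1 ^ 2) * mu j =
      q ^ 2 • (mu j * (gam q 0 ^ 2 * gam q 1 ^ 2)) := by
    intro j
    rw [gam_pow, gam_pow, wt_mul_left (gam_mu (q ^ 2) 0 j) (gam_mu (q ^ 2) 1 j)]
    fin_cases j <;> simp
  have k1 : (gam q 0 ^ 2 * gam q 1 ^ 2) * gam (N := 2) q 1 ^ 2 =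
      (1 : ℂ) • (gam q 1 ^ 2 * (gam q 0 ^ 2 * gam q 1 ^ 2)) := by
    rw [one_smul]
    exact (((gam_comm q q 1 0).pow_pow 2 2).mul_right (Commute.refl _)).eq.symm
  have h1 := wt_map (wt_mul k1 (key 0)) (q ^ 2) (gam q 0 * der q 0)
  have h2 := wt_map (key 1) (q ^ 2) (mu (N := 1) 0)
  rw [one_mul] at h1
  simp only [opE, mul_add, add_mul, mul_smul_comm, smul_mul_assoc, smul_add] at *
  simp only [opK, smul_mul_assoc] at *
  rw [h1, h2]
  simp only [mul_smul_comm, smul_smul]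
  ring_nf

theorem opK_opF {q : ℂ} (hq : q ≠ 0) : opK q * opF q = (q ^ 2)⁻¹ • (opF q * opK q) := by
  have key : ∀ j : Fin 2, (gam q 0 ^ 2 * gam q 1 ^ 2) * der (q ^ 2) j =
      (q ^ 2)⁻¹ • (der (q ^ 2) j * (gam q 0 ^ 2 * gam q 1 ^ 2)) := by
    intro j
    have h2 : q ^ 2 ≠ 0 := pow_ne_zero 2 hq
    rw [gam_pow, gam_pow, wt_mul_left (gam_der h2 _ 0 j) (gam_der h2 _ 1 j)]
    fin_cases j <;> simp
  have k1 : (gam q 0 ^ 2 * gam q 1 ^ 2) * gam (N := 2) q⁻¹ 0 ^ 2 =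
      (1 : ℂ) • (gam q⁻¹ 0 ^ 2 * (gam q 0 ^ 2 * gam q 1 ^ 2)) := by
    rw [one_smul]
    exact (((gam_comm q⁻¹ q 0 0).pow_pow 2 2).mul_right
      ((gam_comm q⁻¹ q 0 1).pow_pow 2 2)).eq.symm
  have h1 := wt_map (wt_mul k1 (key 1)) (q ^ 2) (gam q 0 * der q 0)
  have h2 := wt_map (key 0) (q ^ 2) (mu (N := 1) 0)
  rw [one_mul] at h1
  exact wt_sub (A := Module.End ℂ PS) h2 h1

theorem opE_opF_cross {q : ℂ} (hq : q ≠ 0) :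
    (gam q 1 ^ 2 * mu 0) * (gam q⁻¹ 0 ^ 2 * der (q ^ 2) 1) =
      (gam q⁻¹ 0 ^ 2 * der (q ^ 2) (1 : Fin 2)) * (gam q 1 ^ 2 * mu 0) := by
  have h2 : q ^ 2 ≠ 0 := pow_ne_zero 2 hq
  have a := gam_mu (q⁻¹ ^ 2) (0 : Fin 2) 0
  have b := gam_der h2 (q ^ 2) (1 : Fin 2) 1
  have c := gam_mu (q ^ 2) (1 : Fin 2) 0
  have d := gam_der (pow_ne_zero 2 (inv_ne_zero hq)) (q ^ 2) (0 : Fin 2) 1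
  have e := (gam_comm (q ^ 2) (q⁻¹ ^ 2) (1 : Fin 2) 0).eq
  have f := (der_comm_mu (N := 2) (q ^ 2) (i := 1) (j := 0) (by decide)).eq
  simp only [if_true, one_smul, if_neg (show (1 : Fin 2) ≠ 0 by decide),
    if_neg (show (0 : Fin 2) ≠ 1 by decide)] at a b c d
  rw [gam_pow, gam_pow]
  set G := gam (N := 2) (q ^ 2) 1
  set H := gam (N := 2) (q⁻¹ ^ 2) 0
  set m := mu (N := 2) 0
  set D := der (N := 2) (q ^ 2) 1
  calc G * m * (H * D) = m * (G * H) * D := by rw [c]; simp only [mul_assoc]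
    _ = m * H * (G * D) := by rw [e]; simp only [mul_assoc]
    _ = (q ^ 2)⁻¹ • (m * H * D * G) := by rw [b, mul_smul_comm]; simp only [mul_assoc]
    _ = (H * m) * (D * G) := by
      rw [a, smul_mul_assoc, inv_pow]
      simp only [mul_assoc]
    _ = H * (D * m) * G := by rw [f]; simp only [mul_assoc]
    _ = H * D * (G * m) := by rw [c]; simp only [mul_assoc]

theorem mu_gam_der {q : ℂ} (hq : q ≠ 0) (β : Fin 1 →₀ ℕ) :
    (mu 0 * (gam q 0 * der q 0) : Module.End ℂ (P 1)) (MvPolynomial.monomial β 1) =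
      (q⁻¹ * q ^ β 0 * qInt q (β 0)) • MvPolynomial.monomial β 1 := by
  have b := gam_der hq q (0 : Fin 1) 0
  rw [if_pos rfl] at b
  rw [b, mul_smul_comm, ← mul_assoc, LinearMap.smul_apply, Module.End.mul_apply, gam_monomial,
    map_smul, mu_der, smul_smul, smul_smul]

theorem gam_der_mu {N : ℕ} (a c : ℂ) (i j : Fin N) (β : Fin N →₀ ℕ) :
    ((gam a i * der c j) * mu j) (MvPolynomial.monomial β 1) =
      (a ^ β i * qInt c (β j + 1)) • MvPolynomial.monomial β 1 := by
  rw [mul_assoc, Module.End.mul_apply, der_mu, map_smul, gam_monomial, smul_smul, mul_comm]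

theorem gam_mu_der {N : ℕ} (a c : ℂ) (i j : Fin N) (β : Fin N →₀ ℕ) :
    ((gam a i * mu j) * der c j) (MvPolynomial.monomial β 1) =
      (a ^ β i * qInt c (β j)) • MvPolynomial.monomial β 1 := by
  rw [mul_assoc, Module.End.mul_apply, mu_der, map_smul, gam_monomial, smul_smul, mul_comm]

theorem der_gam_mu {N : ℕ} (a c : ℂ) {i j : Fin N} (h : i ≠ j) (β : Fin N →₀ ℕ) :
    (der c j * (gam a i * mu j)) (MvPolynomial.monomial β 1) =
      (a ^ β i * qInt c (β j + 1)) • MvPolynomial.monomial β 1 := by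
  rw [gam_mu, if_neg h, one_smul, ← mul_assoc, Module.End.mul_apply, gam_monomial, map_smul,
    der_mu, smul_smul]

theorem mu_gam_der' {N : ℕ} (a c : ℂ) {i j : Fin N} (h : i ≠ j) (β : Fin N →₀ ℕ) :
    (mu j * (gam a i * der c j)) (MvPolynomial.monomial β 1) =
      (a ^ β i * qInt c (β j)) • MvPolynomial.monomial β 1 := by
  have b := gam_mu a i j
  rw [if_neg h, one_smul] at b
  rw [← mul_assoc, ← b, gam_mu_der]

theorem opE_opF {q : ℂ} (hq : IsGeneric q) :
    opE q * opF q - opF q * opE q = (q - q⁻¹)⁻¹ • (opK q - opKInv q) := by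
  have h0 := hq.ne_zero
  have bc : (mu 1 * der (q ^ 2) 0 : Module.End ℂ (P 2)) = der (q ^ 2) 0 * mu 1 :=
    (der_comm_mu (q ^ 2) (by decide)).eq.symm
  have expand : ∀ (c d : ℂ) (X Y X' Y' : Module.End ℂ PS), X * Y' = Y' * X → Y * X' = X' * Y →
      (c • (d • X + Y)) * (X' - Y') - (X' - Y') * (c • (d • X + Y)) =
        c • (d • (X * X' - X' * X) - (Y * Y' - Y' * Y)) :=
    fun c d X Y X' Y' h h' => comm_expand (A := Module.End ℂ PS) h h'
  rw [opE, opF, expand]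
  rotate_left
  · rw [← TensorProduct.map_mul, ← TensorProduct.map_mul, opE_opF_cross h0]
  · rw [← TensorProduct.map_mul, ← TensorProduct.map_mul, bc]
  simp only [← TensorProduct.map_mul]
  refine ps_ext fun α β => ?_
  simp only [LinearMap.smul_apply, LinearMap.sub_apply, TensorProduct.map_tmul, gam_pow,
    mu_gam_der h0, gam_der_mu, gam_mu_der, der_gam_mu _ _ (show (1 : Fin 2) ≠ 0 by decide),
    mu_gam_der' _ _ (show (0 : Fin 2) ≠ 1 by decide), opK_apply, opKInv_apply,
    ← TensorProduct.smul_tmul', TensorProduct.tmul_smul, smul_smul]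
  refine scalar_expand ?_
  have hs := hq.sub_inv_ne_zero
  have hs2 : q ^ 2 - 1 ≠ 0 := sub_ne_zero.2 (hq.pow_ne_one 2 (by norm_num))
  have ht : q ^ 4 - 1 ≠ 0 := sub_ne_zero.2 (hq.pow_ne_one 4 (by norm_num))
  rw [qInt_two hq]
  simp only [qInt, inv_pow, pow_add, pow_mul, pow_one]
  field_simp
  ring

/-- The representation `σ` of `U_q(sl₂)` on `P(S)`. -/
def sigma (q : ℂ) (hq : IsGeneric q) : Uq q →ₐ[ℂ] Module.End ℂ PS :=
  Uq.lift q (opE q) (opF q) (opK q) (opKInv q)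
    (opK_mul_opKInv hq.ne_zero) (opKInv_mul_opK hq.ne_zero)
    (wt_conj opK_opE (opK_mul_opKInv hq.ne_zero) rfl)
    (wt_conj (opK_opF hq.ne_zero) (opK_mul_opKInv hq.ne_zero) rfl)
    (opE_opF hq)

/-! ### Representations -/

section representations

/-- The action of `A ⊗ B` on the outer tensor product `V ⊗ W` of an `A`-module and a `B`-module,
`(a ⊗ b) (v ⊗ w) = a v ⊗ b w`. -/
def outerAct (A B V W : Type*) [Ring A] [Algebra ℂ A] [Ring B] [Algebra ℂ B]
    [AddCommGroup V] [Module ℂ V] [Module A V] [IsScalarTower ℂ A V]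
    [AddCommGroup W] [Module ℂ W] [Module B W] [IsScalarTower ℂ B W] :
    A ⊗[ℂ] B →ₐ[ℂ] Module.End ℂ (V ⊗[ℂ] W) :=
  (Module.endTensorEndAlgHom (R := ℂ) (S := ℂ) (A := ℂ)).comp
    (Algebra.TensorProduct.map (Algebra.lsmul ℂ ℂ V) (Algebra.lsmul ℂ ℂ W))

variable {R V W : Type*} [Ring R] [Algebra ℂ R] [AddCommGroup V] [Module ℂ V]
  [AddCommGroup W] [Module ℂ W]

/-- A representation is irreducible if it is nonzero and has no proper nonzero invariant
subspace. -/
def IsIrreducibleRep (ρ : R →ₐ[ℂ] Module.End ℂ V) : Prop :=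
  Nontrivial V ∧ ∀ N : Submodule ℂ V, (∀ r, ∀ x ∈ N, ρ r x ∈ N) → N = ⊥ ∨ N = ⊤

/-- Isomorphism of representations. -/
def RepIso (ρ : R →ₐ[ℂ] Module.End ℂ V) (τ : R →ₐ[ℂ] Module.End ℂ W) : Prop :=
  ∃ φ : V ≃ₗ[ℂ] W, ∀ r x, φ (ρ r x) = τ r (φ x)

end representations

/-! ### Symplectic monogenics -/

/-- `S₊ = ℂ[y²]`, the span of the even powers of `y`. -/
def SPlus : Submodule ℂ (P 1) := Submodule.span ℂ (Set.range fun n : ℕ => MvPolynomial.X 0 ^ (2 * n))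

/-- `S₋ = y ℂ[y²]`, the span of the odd powers of `y`. -/
def SMinus : Submodule ℂ (P 1) :=
  Submodule.span ℂ (Set.range fun n : ℕ => MvPolynomial.X 0 ^ (2 * n + 1))

/-- The subspace `ℂ[x₁, x₂]^d ⊗ T` of `P(S)`, for a subspace `T` of `S = ℂ[y]`. -/
def degTensor (d : ℕ) (T : Submodule ℂ (P 1)) : Submodule ℂ PS :=
  LinearMap.range (TensorProduct.mapIncl (MvPolynomial.homogeneousSubmodule (Fin 2) ℂ d) T)

/-- `P(S)^d`, the part of degree `d` in `x₁, x₂`. -/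
def PSdeg (d : ℕ) : Submodule ℂ PS := degTensor d ⊤

/-- The symplectic monogenics `M^d = ker F ∩ P(S)^d`. -/
def Mono (q : ℂ) (d : ℕ) : Submodule ℂ PS := LinearMap.ker (opF q) ⊓ PSdeg d

/-- `M^d₊`, the monogenics that are even in `y`. -/
def MonoPlus (q : ℂ) (d : ℕ) : Submodule ℂ PS := LinearMap.ker (opF q) ⊓ degTensor d SPlus

/-- `M^d₋`, the monogenics that are odd in `y`. -/
def MonoMinus (q : ℂ) (d : ℕ) : Submodule ℂ PS := LinearMap.ker (opF q) ⊓ degTensor d SMinus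

/-- `E^k (M^d)`. -/
def rowEntry (q : ℂ) (d k : ℕ) : Submodule ℂ PS := (Mono q d).map (opE q ^ k)

/-- The lowest weight `(q²)^(1/2 - d)` for `(d, true)` and `(q²)^(3/2 + d)` for `(d, false)`, where
the square root of `q²` is `q`. -/
def lowWt (q : ℂ) : ℕ × Bool → ℂ
  | (d, true) => q ^ (1 - 2 * (d : ℤ))
  | (d, false) => q ^ (3 + 2 * (d : ℤ))

end

end QMetaplectic

open QMetaplectic

namespace QMetaplectic

noncomputable section

/-! ### Lowest weight vectors -/

/-! Everything rests on lowest weight vectors. If `f v = 0` and `k v = lam v`, then `f e^n v` is a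
multiple of `e^(n-1) v`, and up to a fixed factor the scalar is `(q^n - q^(-n)) (lam q^(n-1) - lam⁻¹
q^(1-n))`. For a weight satisfying `GenericWt` it never vanishes for `n ≥ 1`. Then some power of `f`
brings any nonzero combination of the `e^n v` back to a multiple of `v`. So the universal module has
no proper nonzero submodule, it coincides with `L`, and every nonzero lowest weight vector generates
a copy of `L` (`IsLowest.exists_embedding`). All weights that occur are of this kind: odd powers of
`q` over `U_{q²}`, positive powers of `q` over `U_q`.

That the two actions commute is a computation on the monomials `x₁^a x₂^b y^c`.

For the monogenics, `F x = 0` is a two-term recursion on coefficients (`coef_opF_succ`) that raises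
the exponent of `x₁`. Hence a monogenic is determined by its part at `x₁ = 0` (`Mono_eq_zero`),
where `e` of `U_{q²}` merely multiplies by `y² / [2]_q`. Even monogenics are therefore spanned by
the `e^n` applied to `x₂^d`. On odd ones the same recursion kills the odd powers of `y` below
`y^(2d+1)` at `x₁ = 0` (`coef_Mono_odd`); the explicit vector `oddLow` attains this bound and
generates that half.

A monogenic of degree `d` is a lowest weight vector of weight `q^(2d+2)` for `U_q`, so `F E` acts on
each `E^k(M^d)` by a nonzero scalar. This makes `E` injective along the rows. It also fills the
columns by induction: for `x` of degree `d + 1` choose `w` of degree `d` with `F x = F E w`; then `x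
- E w` is monogenic. Independence comes from the Casimir operator, a scalar on each row, with
distinct scalars on distinct rows.

The joint isomorphism sends `p ⊗ e^k v` to `E^k` of the monogenic parametrized by `p`
(`exists_tensor_embedding`). Irreducibility of the summands follows by applying `f^n ⊗ u`, and they
are told apart by comparing lowest weights. -/

theorem Uq.induction {q : ℂ} {p : Uq q → Prop} (scalar : ∀ c : ℂ, p (algebraMap ℂ _ c))
    (gen : ∀ g, p (Uq.gen q g)) (mul : ∀ u v, p u → p v → p (u * v))
    (add : ∀ u v, p u → p v → p (u + v)) (u : Uq q) : p u := by
  obtain ⟨x, rfl⟩ : ∃ x, Uq.mk q x = u := RingQuot.mkAlgHom_surjective ℂ (UqRel q) u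
  induction x using FreeAlgebra.induction with
  | grade0 r => rw [AlgHom.commutes]; exact scalar r
  | grade1 g => exact gen g
  | mul a b ha hb => rw [map_mul]; exact mul _ _ ha hb
  | add a b ha hb => rw [map_add]; exact add _ _ ha hb

theorem Uq.lift_gen {A : Type*} [Ring A] [Algebra ℂ A] (q : ℂ) (E F K K' : A) (h₁ : K * K' = 1)
    (h₂ : K' * K = 1) (h₃ : K * E * K' = q ^ 2 • E) (h₄ : K * F * K' = (q ^ 2)⁻¹ • F)
    (h₅ : E * F - F * E = (q - q⁻¹)⁻¹ • (K - K')) (g : Gen) :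
    Uq.lift q E F K K' h₁ h₂ h₃ h₄ h₅ (Uq.gen q g) =
      match g with
      | .e => E
      | .f => F
      | .k => K
      | .kinv => K' := by
  unfold Uq.lift Uq.gen Uq.mk
  erw [RingQuot.liftAlgHom_mkAlgHom_apply]
  refine (FreeAlgebra.lift_ι_apply _ _).trans ?_
  cases g <;> rfl

theorem Uq.k_mul_e (q : ℂ) : k q * e q = q ^ 2 • (e q * k q) := by
  rw [← smul_mul_assoc, ← k_e, mul_assoc, kinv_mul_k, mul_one]

theorem Uq.f_mul_e (q : ℂ) : f q * e q = e q * f q - (q - q⁻¹)⁻¹ • (k q - kinv q) := by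
  rw [← e_f]; abel

/-- `v` is annihilated by `f` and has weight `lam`. -/
structure IsLowest {q : ℂ} {V : Type*} [AddCommGroup V] [Module ℂ V]
    (ρ : Uq q →ₐ[ℂ] Module.End ℂ V) (lam : ℂ) (v : V) : Prop where
  f_apply : ρ (Uq.f q) v = 0
  k_apply : ρ (Uq.k q) v = lam • v

/-- The weight `lam` is nonzero and the universal module of lowest weight `lam` has no further
lowest weight vectors. -/
structure GenericWt (q lam : ℂ) : Prop where
  ne_zero : lam ≠ 0
  sq_ne : ∀ n : ℕ, lam ^ 2 * q ^ (2 * n) ≠ 1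

/-- The scalar `c` with `f e ^ n v = -c e ^ (n - 1) v` for a lowest weight vector `v`. -/
def lowerCoeff (q lam : ℂ) (n : ℕ) : ℂ :=
  (q ^ n - (q ^ n)⁻¹) * (lam * q ^ n * q⁻¹ - lam⁻¹ * (q ^ n)⁻¹ * q) / (q - q⁻¹) ^ 2

theorem IsGeneric.pow_injective {q : ℂ} (hq : IsGeneric q) :
    Function.Injective fun n : ℕ => q ^ n := by
  have key : ∀ m n : ℕ, q ^ m = q ^ (m + n) → n = 0 := by
    intro m n h
    by_contra hn
    refine hq.pow_ne_one n (Nat.pos_of_ne_zero hn) ?_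
    rw [pow_add] at h
    exact (mul_eq_left₀ (pow_ne_zero m hq.ne_zero)).1 h.symm
  intro m n h
  rcases le_total m n with hmn | hmn
  · obtain ⟨d, rfl⟩ := Nat.exists_eq_add_of_le hmn
    rw [key m d h, add_zero]
  · obtain ⟨d, rfl⟩ := Nat.exists_eq_add_of_le hmn
    rw [key n d h.symm, add_zero]

/-- The first factor vanishes only if `q^(2(n+1)) = 1`, the second only if `lam² q^(2n) = 1`. The
first is excluded by `q` not being a root of unity, the second is what `GenericWt` forbids. -/
theorem lowerCoeff_ne_zero {q lam : ℂ} (hq : IsGeneric q) (hl : GenericWt q lam) (n : ℕ) :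
    lowerCoeff q lam (n + 1) ≠ 0 := by
  have h0 := hq.ne_zero
  have hl0 := hl.ne_zero
  have hp : q ^ n ≠ 0 := pow_ne_zero _ h0
  refine div_ne_zero (mul_ne_zero ?_ ?_) (pow_ne_zero _ hq.sub_inv_ne_zero)
  · intro h
    refine hq.pow_ne_one (2 * (n + 1)) (by omega) ?_
    rw [sub_eq_zero] at h
    calc q ^ (2 * (n + 1)) = q ^ (n + 1) * q ^ (n + 1) := by ring
      _ = 1 := by
        nth_rewrite 1 [h]
        exact inv_mul_cancel₀ (pow_ne_zero _ h0)
  · intro h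
    refine hl.sq_ne n ?_
    rw [pow_succ, sub_eq_zero] at h
    field_simp at h
    rw [mul_comm 2 n, pow_mul]
    linear_combination h

namespace IsLowest
variable {q lam : ℂ} {V : Type*} [AddCommGroup V] [Module ℂ V]
  {ρ : Uq q →ₐ[ℂ] Module.End ℂ V} {v : V}

theorem k_pow (h : IsLowest ρ lam v) (n : ℕ) :
    ρ (Uq.k q) ((ρ (Uq.e q) ^ n) v) = (lam * q ^ (2 * n)) • (ρ (Uq.e q) ^ n) v := by
  induction n with
  | zero => simp [h.k_apply]
  | succ n ih =>
    rw [pow_succ', Module.End.mul_apply, ← Module.End.mul_apply, ← map_mul, Uq.k_mul_e, map_smul,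
      map_mul, LinearMap.smul_apply, Module.End.mul_apply, ih, map_smul, smul_smul]
    congr 1
    ring

theorem kinv_pow (h : IsLowest ρ lam v) (hq : q ≠ 0) (hl : lam ≠ 0) (n : ℕ) :
    ρ (Uq.kinv q) ((ρ (Uq.e q) ^ n) v) = (lam * q ^ (2 * n))⁻¹ • (ρ (Uq.e q) ^ n) v := by
  have h1 := congrArg (ρ (Uq.kinv q)) (h.k_pow n)
  rw [← Module.End.mul_apply, ← map_mul, Uq.kinv_mul_k, map_one, Module.End.one_apply,
    map_smul] at h1
  rw [eq_inv_smul_iff₀ (mul_ne_zero hl (pow_ne_zero _ hq)), ← h1]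

theorem f_pow_succ (h : IsLowest ρ lam v) (hq : IsGeneric q) (hl : lam ≠ 0) (n : ℕ) :
    ρ (Uq.f q) ((ρ (Uq.e q) ^ (n + 1)) v) =
      -lowerCoeff q lam (n + 1) • (ρ (Uq.e q) ^ n) v := by
  -- Moving `f` past one `e` costs the weight bracket of `e^n v`. These brackets add up as geometric
  -- sums, whose closed form is `lowerCoeff`.
  have step : ∀ n, ρ (Uq.f q) ((ρ (Uq.e q) ^ (n + 1)) v) =
      ρ (Uq.e q) (ρ (Uq.f q) ((ρ (Uq.e q) ^ n) v)) -
        ((q - q⁻¹)⁻¹ * (lam * q ^ (2 * n) - (lam * q ^ (2 * n))⁻¹)) • (ρ (Uq.e q) ^ n) v := by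
    intro n
    rw [pow_succ', Module.End.mul_apply, ← Module.End.mul_apply, ← map_mul, Uq.f_mul_e, map_sub,
      map_smul, map_sub, map_mul, LinearMap.sub_apply, LinearMap.smul_apply, LinearMap.sub_apply,
      Module.End.mul_apply, h.k_pow, h.kinv_pow hq.ne_zero hl, ← sub_smul, smul_smul]
  have h0 := hq.ne_zero
  have hs := hq.sub_inv_ne_zero
  have hs2 : q ^ 2 - 1 ≠ 0 := sub_ne_zero.2 (hq.pow_ne_one 2 (by norm_num))
  induction n with
  | zero =>
    rw [step, pow_zero, Module.End.one_apply, h.f_apply, map_zero, zero_sub, ← neg_smul]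
    congr 2
    simp only [lowerCoeff]
    field_simp
    ring
  | succ n ih =>
    rw [step, ih, map_smul, ← Module.End.mul_apply, ← pow_succ', ← sub_smul]
    congr 1
    have e1 : q ^ (n + 1) = q ^ n * q := pow_succ _ _
    have e2 : q ^ (n + 1 + 1) = q ^ n * q * q := by rw [pow_succ, pow_succ]
    have e3 : q ^ (2 * (n + 1)) = (q ^ n * q) ^ 2 := by ring
    simp only [lowerCoeff, e1, e2, e3]
    have hx0 : q ^ n ≠ 0 := _root_.pow_ne_zero _ h0
    -- With `q^n` treated as an indeterminate, the recursion for `lowerCoeff` is an identity of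
    -- rational functions.
    generalize q ^ n = x at *
    field_simp
    ring

/-- Up to sign the scalar is the product of the first `n` lowering coefficients, none of which
vanishes. Nonvanishing of the `e^n v` and all irreducibility statements come from here. -/
theorem f_pow_pow (h : IsLowest ρ lam v) (hq : IsGeneric q) (hl : GenericWt q lam) (n : ℕ) :
    ∃ c : ℂ, c ≠ 0 ∧ (ρ (Uq.f q) ^ n) ((ρ (Uq.e q) ^ n) v) = c • v := by
  induction n with
  | zero => exact ⟨1, one_ne_zero, by simp⟩
  | succ n ih =>
    obtain ⟨c, hc, hc'⟩ := ih
    refine ⟨-lowerCoeff q lam (n + 1) * c,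
      mul_ne_zero (neg_ne_zero.2 (lowerCoeff_ne_zero hq hl n)) hc, ?_⟩
    rw [pow_succ (ρ (Uq.f q)), Module.End.mul_apply, h.f_pow_succ hq hl.ne_zero, map_smul, hc',
      smul_smul]

/-- After `m` steps `e^m v` is back at a multiple of `v`, and one more `f` kills it. -/
theorem f_pow_of_lt (h : IsLowest ρ lam v) (hq : IsGeneric q) (hl : GenericWt q lam) {m n : ℕ}
    (hmn : m < n) : (ρ (Uq.f q) ^ n) ((ρ (Uq.e q) ^ m) v) = 0 := by
  obtain ⟨c, -, hc⟩ := h.f_pow_pow hq hl m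
  obtain ⟨d, rfl⟩ := Nat.exists_eq_add_of_lt hmn
  rw [show m + d + 1 = d + 1 + m by ring, pow_add, Module.End.mul_apply, hc, map_smul, pow_succ,
    Module.End.mul_apply, h.f_apply, map_zero, smul_zero]

theorem pow_ne_zero (h : IsLowest ρ lam v) (hq : IsGeneric q) (hl : GenericWt q lam)
    (hv : v ≠ 0) (n : ℕ) : (ρ (Uq.e q) ^ n) v ≠ 0 := by
  intro h0
  obtain ⟨c, hc, hc'⟩ := h.f_pow_pow hq hl n
  rw [h0, map_zero] at hc'
  exact smul_ne_zero hc hv hc'.symm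

theorem wt_injective (hq : IsGeneric q) (hl : lam ≠ 0) :
    Function.Injective fun n : ℕ => lam * q ^ (2 * n) := fun m n h => by
  have := hq.pow_injective (mul_left_cancel₀ hl h)
  omega

/-- The vectors are eigenvectors of `k` with the eigenvalues `lam q^(2n)`, distinct because `q` is
not a root of unity. -/
theorem linearIndependent (h : IsLowest ρ lam v) (hq : IsGeneric q) (hl : GenericWt q lam)
    (hv : v ≠ 0) : LinearIndependent ℂ fun n : ℕ => (ρ (Uq.e q) ^ n) v :=
  Module.End.eigenvectors_linearIndependent' (ρ (Uq.k q)) (fun n : ℕ => lam * q ^ (2 * n))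
    (wt_injective hq hl.ne_zero) _ fun n =>
      ⟨Module.End.mem_eigenspace_iff.2 (h.k_pow n), h.pow_ne_zero hq hl hv n⟩

theorem apply_mem_span (h : IsLowest ρ lam v) (hq : IsGeneric q) (hl : lam ≠ 0) (u : Uq q)
    {x : V} (hx : x ∈ Submodule.span ℂ (Set.range fun n : ℕ => (ρ (Uq.e q) ^ n) v)) :
    ρ u x ∈ Submodule.span ℂ (Set.range fun n : ℕ => (ρ (Uq.e q) ^ n) v) := by
  set S := Submodule.span ℂ (Set.range fun n : ℕ => (ρ (Uq.e q) ^ n) v) with hS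
  have hmem : ∀ n, (ρ (Uq.e q) ^ n) v ∈ S := fun n => Submodule.subset_span ⟨n, rfl⟩
  induction u using Uq.induction generalizing x with
  | scalar c => rw [AlgHom.commutes, Module.algebraMap_end_apply]; exact S.smul_mem c hx
  | mul a b ha hb => rw [map_mul]; exact ha (hb hx)
  | add a b ha hb => rw [map_add]; exact S.add_mem (ha hx) (hb hx)
  | gen g =>
    suffices S ≤ S.comap (ρ (Uq.gen q g)) from this hx
    rw [hS, Submodule.span_le]
    rintro _ ⟨n, rfl⟩
    rw [← hS]
    change ρ (Uq.gen q g) _ ∈ S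
    cases g with
    | e => simpa only [pow_succ', Module.End.mul_apply] using hmem (n + 1)
    | k => exact (h.k_pow n) ▸ S.smul_mem _ (hmem n)
    | kinv => exact (h.kinv_pow hq.ne_zero hl n) ▸ S.smul_mem _ (hmem n)
    | f =>
      cases n with
      | zero => simp [h.f_apply]
      | succ n => exact (h.f_pow_succ hq hl n) ▸ S.smul_mem _ (hmem n)

/-- A nonzero combination of the `e ^ n v` can be moved to `v`. -/
theorem exists_apply_eq (h : IsLowest ρ lam v) (hq : IsGeneric q) (hl : GenericWt q lam)
    {x : V} (hx : x ∈ Submodule.span ℂ (Set.range fun n : ℕ => (ρ (Uq.e q) ^ n) v))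
    (hx0 : x ≠ 0) : ∃ u : Uq q, ρ u x = v := by
  have key : ∀ (n : ℕ) (a : ℕ → ℂ) (x : V), x = ∑ i ∈ Finset.range n, a i • (ρ (Uq.e q) ^ i) v →
      x ≠ 0 → ∃ u : Uq q, ρ u x = v := by
    intro n
    induction n with
    | zero => intro a x hx hx0; exact absurd hx (by simpa using hx0)
    | succ n ih =>
      intro a x hx hx0
      by_cases han : a n = 0
      · exact ih a x (by rw [hx, Finset.sum_range_succ, han, zero_smul, add_zero]) hx0
      · obtain ⟨c, hc, hc'⟩ := h.f_pow_pow hq hl n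
        -- `f^n` kills every term below the top one and returns the top term to a nonzero multiple
        -- of `v`.
        refine ⟨(a n * c)⁻¹ • Uq.f q ^ n, ?_⟩
        rw [map_smul, map_pow, LinearMap.smul_apply, hx, Finset.sum_range_succ, map_add, map_sum,
          Finset.sum_eq_zero, zero_add, map_smul, hc', smul_smul (a n), smul_smul,
          inv_mul_cancel₀ (mul_ne_zero han hc), one_smul]
        intro i hi
        rw [map_smul, h.f_pow_of_lt hq hl (Finset.mem_range.1 hi), smul_zero]
  obtain ⟨a, rfl⟩ := Finsupp.mem_span_range_iff_exists_finsupp.1 hx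
  refine key (a.support.sup id + 1) a _ ?_ hx0
  refine Finset.sum_subset (fun i hi => ?_) (fun i _ hi => ?_)
  · exact Finset.mem_range.2 (Nat.lt_succ_of_le (Finset.le_sup (f := id) hi))
  · simp [Finsupp.notMem_support_iff.1 hi]

end IsLowest

/-! ### The irreducible lowest weight modules -/

section L
variable {q lam : ℂ}

/-- The lowest weight vector of the universal lowest weight module. -/
def Verma.low (q lam : ℂ) : Verma q lam := Submodule.Quotient.mk 1

theorem Verma.smul_low (u : Uq q) : u • Verma.low q lam = Submodule.Quotient.mk u := by
  rw [Verma.low, ← Submodule.Quotient.mk_smul, smul_eq_mul, mul_one]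

theorem Verma.isLowest_low (q lam : ℂ) :
    IsLowest (q := q) (Algebra.lsmul ℂ ℂ (Verma q lam)) lam (Verma.low q lam) where
  f_apply := by
    rw [Algebra.lsmul_apply, Verma.smul_low, Submodule.Quotient.mk_eq_zero]
    exact Submodule.subset_span (by simp)
  k_apply := by
    rw [Algebra.lsmul_apply, ← algebraMap_smul (Uq q) lam, Verma.smul_low, Verma.smul_low,
      Submodule.Quotient.eq]
    exact Submodule.subset_span (by simp)

theorem Verma.span_low (hq : IsGeneric q) (hl : lam ≠ 0) :
    Submodule.span ℂ (Set.range fun n : ℕ =>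
      (Algebra.lsmul ℂ ℂ (Verma q lam) (Uq.e q) ^ n) (Verma.low q lam)) = ⊤ := by
  refine eq_top_iff.2 fun x _ => ?_
  obtain ⟨u, rfl⟩ := Submodule.Quotient.mk_surjective _ x
  rw [← Verma.smul_low]
  exact (Verma.isLowest_low q lam).apply_mem_span hq hl u (Submodule.subset_span ⟨0, by simp⟩)

/-- A nonzero element can be moved to the cyclic generator. The argument does not use that the
module is nonzero, so no PBW basis is required; nonvanishing is obtained later from concrete
vectors. -/
theorem Verma.eq_bot_or_eq_top (hq : IsGeneric q) (hl : GenericWt q lam)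
    (N : Submodule (Uq q) (Verma q lam)) : N = ⊥ ∨ N = ⊤ := by
  refine or_iff_not_imp_left.2 fun hN => ?_
  obtain ⟨x, hx, hx0⟩ := N.ne_bot_iff.1 hN
  obtain ⟨u, hu⟩ := (Verma.isLowest_low q lam).exists_apply_eq hq hl
    (x := x) (by rw [Verma.span_low hq hl.ne_zero]; trivial) hx0
  refine eq_top_iff.2 fun y _ => ?_
  obtain ⟨w, rfl⟩ := Submodule.Quotient.mk_surjective _ y
  rw [← Verma.smul_low, ← hu]
  exact N.smul_mem w (N.smul_mem u hx)

/-- For generic weights the universal lowest weight module is irreducible. -/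
def L.equivVerma (hq : IsGeneric q) (hl : GenericWt q lam) : L q lam ≃ₗ[Uq q] Verma q lam :=
  Submodule.quotEquivOfEqBot _ (by
    refine sSup_eq_bot.2 fun N hN => ?_
    exact (Verma.eq_bot_or_eq_top hq hl N).resolve_right hN)

/-- The lowest weight vector of `L q lam`. -/
def L.low (q lam : ℂ) : L q lam := Submodule.Quotient.mk (Verma.low q lam)

theorem L.equivVerma_low (hq : IsGeneric q) (hl : GenericWt q lam) :
    L.equivVerma hq hl (L.low q lam) = Verma.low q lam := rfl

theorem L.isLowest_low (q lam : ℂ) :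
    IsLowest (q := q) (Algebra.lsmul ℂ ℂ (L q lam)) lam (L.low q lam) where
  f_apply := congrArg (Submodule.mkQ (sSup {N : Submodule (Uq q) (Verma q lam) | N ≠ ⊤}))
    (Verma.isLowest_low q lam).f_apply
  k_apply := congrArg (Submodule.mkQ (sSup {N : Submodule (Uq q) (Verma q lam) | N ≠ ⊤}))
    (Verma.isLowest_low q lam).k_apply

theorem L.exists_smul_low (x : L q lam) : ∃ u : Uq q, u • L.low q lam = x := by
  obtain ⟨y, rfl⟩ := Submodule.Quotient.mk_surjective _ x
  obtain ⟨u, rfl⟩ := Submodule.Quotient.mk_surjective _ y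
  refine ⟨u, ?_⟩
  rw [← Verma.smul_low]
  rfl

theorem L.span_low (hq : IsGeneric q) (hl : lam ≠ 0) :
    Submodule.span ℂ (Set.range fun n : ℕ =>
      (Algebra.lsmul ℂ ℂ (L q lam) (Uq.e q) ^ n) (L.low q lam)) = ⊤ := by
  refine eq_top_iff.2 fun x _ => ?_
  obtain ⟨u, rfl⟩ := L.exists_smul_low x
  exact (L.isLowest_low q lam).apply_mem_span hq hl u (Submodule.subset_span ⟨0, by simp⟩)

theorem L.exists_smul_eq_low (hq : IsGeneric q) (hl : GenericWt q lam) {x : L q lam}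
    (hx : x ≠ 0) : ∃ u : Uq q, u • x = L.low q lam :=
  (L.isLowest_low q lam).exists_apply_eq hq hl (by rw [L.span_low hq hl.ne_zero]; trivial) hx

/-- The basis `e ^ n v` of `L q lam`, where `v` is the lowest weight vector. -/
def L.basis (hq : IsGeneric q) (hl : GenericWt q lam) (h0 : L.low q lam ≠ 0) :
    Module.Basis ℕ ℂ (L q lam) :=
  Module.Basis.mk ((L.isLowest_low q lam).linearIndependent hq hl h0)
    (L.span_low hq hl.ne_zero).ge

theorem L.basis_apply (hq : IsGeneric q) (hl : GenericWt q lam) (h0 : L.low q lam ≠ 0) (n : ℕ) :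
    L.basis hq hl h0 n = (Algebra.lsmul ℂ ℂ (L q lam) (Uq.e q) ^ n) (L.low q lam) := by
  rw [L.basis, Module.Basis.mk_apply]

/-- A lowest weight vector of generic weight generates a copy of `L q lam`. -/
theorem IsLowest.exists_embedding {V : Type*} [AddCommGroup V] [Module ℂ V]
    {ρ : Uq q →ₐ[ℂ] Module.End ℂ V} {v : V} (h : IsLowest ρ lam v) (hq : IsGeneric q)
    (hl : GenericWt q lam) (hv : v ≠ 0) :
    ∃ φ : L q lam →ₗ[ℂ] V, Function.Injective φ ∧ (∀ u x, φ (u • x) = ρ u (φ x)) ∧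
      φ (L.low q lam) = v ∧
      LinearMap.range φ = Submodule.span ℂ (Set.range fun n : ℕ => (ρ (Uq.e q) ^ n) v) := by
  let : Module (Uq q) V := Module.compHom V ρ.toRingHom
  have hsm : ∀ (u : Uq q) (x : V), u • x = ρ u x := fun _ _ => rfl
  have : IsScalarTower ℂ (Uq q) V := ⟨fun c u x => by rw [hsm, hsm, map_smul]; rfl⟩
  let ψ : Verma q lam →ₗ[Uq q] V := Submodule.liftQ _ (LinearMap.toSpanSingleton (Uq q) V v) (by
    rw [Submodule.span_le]
    rintro x (rfl | rfl)
    · simpa [hsm] using h.f_apply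
    · simp [hsm, h.k_apply, Module.algebraMap_end_apply])
  have hψ : ψ (Verma.low q lam) = v := by simp [ψ, Verma.low]
  have hker : LinearMap.ker ψ = ⊥ := by
    -- The kernel cannot be everything, since the generator goes to `v ≠ 0`.
    refine (Verma.eq_bot_or_eq_top hq hl _).resolve_right fun ht => hv ?_
    rw [← hψ]
    exact LinearMap.mem_ker.1 (ht ▸ Submodule.mem_top)
  let φ : L q lam →ₗ[Uq q] V := ψ ∘ₗ (L.equivVerma hq hl).toLinearMap
  have hlow : φ (L.low q lam) = v := by
    rw [← hψ, ← L.equivVerma_low hq hl]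
    rfl
  have hpow : ∀ n : ℕ, φ ((Algebra.lsmul ℂ ℂ (L q lam) (Uq.e q) ^ n) (L.low q lam)) =
      (ρ (Uq.e q) ^ n) v := by
    intro n
    rw [← map_pow, Algebra.lsmul_apply, map_smul, hlow, hsm, map_pow]
  refine ⟨φ.restrictScalars ℂ,
    (LinearMap.ker_eq_bot.1 hker).comp (L.equivVerma hq hl).injective,
    fun u x => φ.map_smul u x, hlow, ?_⟩
  rw [LinearMap.range_eq_map, ← L.span_low hq hl.ne_zero, Submodule.map_span, ← Set.range_comp]
  congr 2
  funext n
  exact hpow n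

end L

/-! ### Outer tensor products -/

theorem outerAct_tmul {A B V W : Type*} [Ring A] [Algebra ℂ A] [Ring B] [Algebra ℂ B]
    [AddCommGroup V] [Module ℂ V] [Module A V] [IsScalarTower ℂ A V]
    [AddCommGroup W] [Module ℂ W] [Module B W] [IsScalarTower ℂ B W] (a : A) (b : B) (x : V)
    (y : W) : outerAct A B V W (a ⊗ₜ b) (x ⊗ₜ y) = (a • x) ⊗ₜ (b • y) := rfl

theorem RepIso.symm {R V W : Type*} [Ring R] [Algebra ℂ R] [AddCommGroup V] [Module ℂ V]
    [AddCommGroup W] [Module ℂ W] {ρ : R →ₐ[ℂ] Module.End ℂ V} {τ : R →ₐ[ℂ] Module.End ℂ W}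
    (h : RepIso ρ τ) : RepIso τ ρ := by
  obtain ⟨φ, hφ⟩ := h
  refine ⟨φ.symm, fun r x => ?_⟩
  rw [LinearEquiv.symm_apply_eq, hφ, LinearEquiv.apply_symm_apply]

/-- Each coordinate functional of an eigenbasis is an eigenvector of the transpose, so any nonzero
coordinate of `x` forces `c` to be the corresponding `w i`. -/
theorem exists_eigenvalue_eq {ι V : Type*} [AddCommGroup V] [Module ℂ V]
    (b : Module.Basis ι ℂ V) {T : Module.End ℂ V} {w : ι → ℂ} (hT : ∀ i, T (b i) = w i • b i)
    {x : V} (hx : x ≠ 0) {c : ℂ} (hc : T x = c • x) : ∃ i, c = w i := by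
  have key : ∀ i y, b.repr (T y) i = w i * b.repr y i := by
    intro i y
    have : b.coord i ∘ₗ T = w i • b.coord i := b.ext fun j => by
      rw [LinearMap.comp_apply, hT, map_smul, LinearMap.smul_apply, Module.Basis.coord_apply,
        Module.Basis.repr_self]
      by_cases hij : j = i
      · rw [hij]
      · simp [hij]
    exact LinearMap.congr_fun this y
  obtain ⟨i, hi⟩ : ∃ i, b.repr x i ≠ 0 := by
    by_contra! h
    exact hx (b.repr.map_eq_zero_iff.1 (Finsupp.ext h))
  refine ⟨i, mul_right_cancel₀ hi ?_⟩
  rw [← key, hc]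
  simp

section outer
variable {p lam q mu' : ℂ}

/-- The isomorphism carries the tensor of the lowest weight vectors to a common eigenvector of `k ⊗
1` and `1 ⊗ k`, and the eigenvalues available in the target are those on its basis of the `e^m v ⊗
e^n w`. Used in both directions, this yields equality of the weights. -/
theorem exists_eq_wt_of_repIso {lam' mu'' : ℂ} (hp : IsGeneric p) (hq : IsGeneric q)
    (hl : GenericWt p lam) (hm : GenericWt q mu') (hl' : GenericWt p lam')
    (hm' : GenericWt q mu'') (h0 : L.low p lam ≠ 0) (h1 : L.low q mu' ≠ 0)
    (h0' : L.low p lam' ≠ 0) (h1' : L.low q mu'' ≠ 0)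
    (h : RepIso (outerAct (Uq p) (Uq q) (L p lam) (L q mu'))
      (outerAct (Uq p) (Uq q) (L p lam') (L q mu''))) :
    (∃ n : ℕ, lam = lam' * p ^ (2 * n)) ∧ ∃ n : ℕ, mu' = mu'' * q ^ (2 * n) := by
  obtain ⟨φ, hφ⟩ := h
  let b := (L.basis hp hl h0).tensorProduct (L.basis hq hm h1)
  let b' := (L.basis hp hl' h0').tensorProduct (L.basis hq hm' h1')
  have hb : b (0, 0) = L.low p lam ⊗ₜ L.low q mu' := by
    simp only [b, Module.Basis.tensorProduct_apply, L.basis_apply, pow_zero, Module.End.one_apply]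
  have hne : φ (b (0, 0)) ≠ 0 := by
    rw [Ne, LinearEquiv.map_eq_zero_iff]
    exact b.ne_zero _
  constructor
  · have e : outerAct (Uq p) (Uq q) (L p lam') (L q mu'') (Uq.k p ⊗ₜ 1) (φ (b (0, 0))) =
        lam • φ (b (0, 0)) := by
      rw [← hφ, hb, outerAct_tmul, one_smul, ← map_smul, TensorProduct.smul_tmul']
      congr 2
      exact (L.isLowest_low p lam).k_apply
    obtain ⟨i, hi⟩ := exists_eigenvalue_eq b' (w := fun i => lam' * p ^ (2 * i.1)) (fun i => by
      rw [Module.Basis.tensorProduct_apply', outerAct_tmul, one_smul, L.basis_apply,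
        TensorProduct.smul_tmul', ← (L.isLowest_low p lam').k_pow i.1]
      rfl) hne e
    exact ⟨_, hi⟩
  · have e : outerAct (Uq p) (Uq q) (L p lam') (L q mu'') (1 ⊗ₜ Uq.k q) (φ (b (0, 0))) =
        mu' • φ (b (0, 0)) := by
      rw [← hφ, hb, outerAct_tmul, one_smul, ← map_smul, ← TensorProduct.tmul_smul]
      congr 2
      exact (L.isLowest_low q mu').k_apply
    obtain ⟨i, hi⟩ := exists_eigenvalue_eq b' (w := fun i => mu'' * q ^ (2 * i.2)) (fun i => by
      rw [Module.Basis.tensorProduct_apply', outerAct_tmul, one_smul, L.basis_apply hq,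
        ← TensorProduct.tmul_smul, ← (L.isLowest_low q mu'').k_pow i.2]
      rfl) hne e
    exact ⟨_, hi⟩

/-- Expand a nonzero element as a sum of `e^i v ⊗ a i` with last nonzero term at `n`. Then a
multiple of `f^n` kills the lower terms in the first factor, while a suitable `u` moves `a n` to the
lowest weight vector of the second. The resulting tensor generates the whole space. -/
theorem outerAct_isIrreducible (hp : IsGeneric p) (hq : IsGeneric q)
    (hl : GenericWt p lam) (hm : GenericWt q mu') (h0 : L.low p lam ≠ 0)
    (h1 : L.low q mu' ≠ 0) :
    IsIrreducibleRep (outerAct (Uq p) (Uq q) (L p lam) (L q mu')) := by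
  let b := L.basis hp hl h0
  have hlow := L.isLowest_low p lam
  refine ⟨⟨_, 0, (b.tensorProduct (L.basis hq hm h1)).ne_zero (0, 0)⟩, fun N hN => ?_⟩
  refine or_iff_not_imp_left.2 fun hbot => ?_
  obtain ⟨x, hx, hx0⟩ := N.ne_bot_iff.1 hbot
  have key : ∀ (n : ℕ) (a : ℕ → L q mu') (x : L p lam ⊗[ℂ] L q mu'),
      x = ∑ i ∈ Finset.range n, b i ⊗ₜ a i → x ≠ 0 → x ∈ N →
        L.low p lam ⊗ₜ L.low q mu' ∈ N := by
    intro n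
    induction n with
    | zero => intro a x hx hx0; exact absurd hx (by simpa using hx0)
    | succ n ih =>
      intro a x hx hx0 hxN
      by_cases han : a n = 0
      · exact ih a x (by rw [hx, Finset.sum_range_succ, han, TensorProduct.tmul_zero, add_zero])
          hx0 hxN
      · obtain ⟨c, hc, hc'⟩ := hlow.f_pow_pow hp hl n
        obtain ⟨u, hu⟩ := L.exists_smul_eq_low hq hm han
        have hx2 : outerAct (Uq p) (Uq q) (L p lam) (L q mu') ((c⁻¹ • Uq.f p ^ n) ⊗ₜ u) x =
            L.low p lam ⊗ₜ L.low q mu' := by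
          have hf : ∀ i, (c⁻¹ • Uq.f p ^ n) • b i = c⁻¹ •
              (Algebra.lsmul ℂ ℂ (L p lam) (Uq.f p) ^ n)
                ((Algebra.lsmul ℂ ℂ (L p lam) (Uq.e p) ^ i) (L.low p lam)) := fun i => by
            rw [smul_assoc, L.basis_apply, ← map_pow (Algebra.lsmul ℂ ℂ (L p lam)) (Uq.f p)]
            rfl
          rw [hx, map_sum, Finset.sum_range_succ, Finset.sum_eq_zero, zero_add, outerAct_tmul, hu,
            hf, hc', smul_smul, inv_mul_cancel₀ hc, one_smul]
          intro i hi
          rw [outerAct_tmul, hf, hlow.f_pow_of_lt hp hl (Finset.mem_range.1 hi), smul_zero,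
            TensorProduct.zero_tmul]
        rw [← hx2]
        exact hN _ _ hxN
  have hmem : L.low p lam ⊗ₜ L.low q mu' ∈ N := by
    obtain ⟨a, rfl⟩ := (TensorProduct.equivFinsuppOfBasisLeft b).symm.surjective x
    rw [TensorProduct.equivFinsuppOfBasisLeft_symm_apply] at hx hx0
    refine key (a.support.sup id + 1) a _ ?_ hx0 hx
    refine Finset.sum_subset (fun i hi => ?_) (fun i _ hi => ?_)
    · exact Finset.mem_range.2 (Nat.lt_succ_of_le (Finset.le_sup (f := id) hi))
    · simp [Finsupp.notMem_support_iff.1 hi]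
  refine eq_top_iff.2 fun y _ => ?_
  induction y using TensorProduct.induction_on with
  | zero => exact N.zero_mem
  | add y z hy hz => exact N.add_mem (hy trivial) (hz trivial)
  | tmul y z =>
    obtain ⟨u, rfl⟩ := L.exists_smul_low y
    obtain ⟨w, rfl⟩ := L.exists_smul_low z
    exact hN (u ⊗ₜ w) _ hmem

end outer

/-! ### The monomial basis -/

/-- Exponents in two variables as pairs. -/
def expEquiv : (Fin 2 →₀ ℕ) ≃ ℕ × ℕ := Finsupp.equivFunOnFinite.trans (finTwoArrowEquiv ℕ)

/-- Exponents in one variable as natural numbers. -/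
def expEquiv₁ : (Fin 1 →₀ ℕ) ≃ ℕ := Finsupp.equivFunOnFinite.trans (Equiv.funUnique (Fin 1) ℕ)

/-- The monomial `x₁ ^ a x₂ ^ b`. -/
def xmon (a b : ℕ) : P 2 := MvPolynomial.monomial (expEquiv.symm (a, b)) 1

/-- The monomial `y ^ c`. -/
def ymon (c : ℕ) : P 1 := MvPolynomial.monomial (expEquiv₁.symm c) 1

/-- The monomial `x₁ ^ a x₂ ^ b y ^ c`. -/
def mon (a b c : ℕ) : PS := xmon a b ⊗ₜ ymon c

theorem expEquiv_symm_zero (a b : ℕ) : expEquiv.symm (a, b) 0 = a := rfl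
theorem expEquiv_symm_one (a b : ℕ) : expEquiv.symm (a, b) 1 = b := rfl
theorem expEquiv₁_symm_zero (c : ℕ) : expEquiv₁.symm c 0 = c := rfl

/-- The basis of all monomials `x₁ ^ a x₂ ^ b y ^ c`. -/
def monBasis : Module.Basis (ℕ × ℕ × ℕ) ℂ PS :=
  ((MvPolynomial.basisMonomials (Fin 2) ℂ).tensorProduct
    (MvPolynomial.basisMonomials (Fin 1) ℂ)).reindex
      ((Equiv.prodCongr expEquiv expEquiv₁).trans (Equiv.prodAssoc ℕ ℕ ℕ))

theorem monBasis_apply (i : ℕ × ℕ × ℕ) : monBasis i = mon i.1 i.2.1 i.2.2 := by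
  rw [monBasis, Module.Basis.reindex_apply, Module.Basis.tensorProduct_apply']
  simp [mon, xmon, ymon]

theorem mon_ext {V : Type*} [AddCommGroup V] [Module ℂ V] {A B : PS →ₗ[ℂ] V}
    (h : ∀ a b c, A (mon a b c) = B (mon a b c)) : A = B :=
  monBasis.ext fun i => by simpa only [monBasis_apply] using h _ _ _

theorem mu_zero_xmon (a b : ℕ) : mu 0 (xmon a b) = xmon (a + 1) b := by
  rw [xmon, mu_monomial, xmon]
  congr 2
  ext i
  fin_cases i <;> simp [expEquiv_symm_zero, expEquiv_symm_one]

theorem mu_one_xmon (a b : ℕ) : mu 1 (xmon a b) = xmon a (b + 1) := by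
  rw [xmon, mu_monomial, xmon]
  congr 2
  ext i
  fin_cases i <;> simp [expEquiv_symm_zero, expEquiv_symm_one]

theorem mu_ymon (c : ℕ) : mu 0 (ymon c) = ymon (c + 1) := by
  rw [ymon, mu_monomial, ymon]
  congr 2
  ext
  simp [expEquiv₁_symm_zero]

theorem gam_zero_xmon (t : ℂ) (a b : ℕ) : gam t 0 (xmon a b) = t ^ a • xmon a b := by
  rw [xmon, gam_monomial, expEquiv_symm_zero]

theorem gam_one_xmon (t : ℂ) (a b : ℕ) : gam t 1 (xmon a b) = t ^ b • xmon a b := by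
  rw [xmon, gam_monomial, expEquiv_symm_one]

theorem gam_ymon (t : ℂ) (c : ℕ) : gam t 0 (ymon c) = t ^ c • ymon c := by
  rw [ymon, gam_monomial, expEquiv₁_symm_zero]

theorem der_zero_xmon (t : ℂ) (a b : ℕ) :
    der t 0 (xmon a b) = qInt t a • xmon (a - 1) b := by
  rw [xmon, der_monomial, xmon, expEquiv_symm_zero]
  congr 3
  ext i
  fin_cases i <;> simp [expEquiv_symm_zero, expEquiv_symm_one]

theorem der_one_xmon (t : ℂ) (a b : ℕ) :
    der t 1 (xmon a b) = qInt t b • xmon a (b - 1) := by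
  rw [xmon, der_monomial, xmon, expEquiv_symm_one]
  congr 3
  ext i
  fin_cases i <;> simp [expEquiv_symm_zero, expEquiv_symm_one]

theorem der_ymon (t : ℂ) (c : ℕ) : der t 0 (ymon c) = qInt t c • ymon (c - 1) := by
  rw [ymon, der_monomial, ymon, expEquiv₁_symm_zero]
  congr 3
  ext
  simp [expEquiv₁_symm_zero]

theorem qInt_zero (t : ℂ) : qInt t 0 = 0 := by simp [qInt]

theorem qInt_succ_ne_zero {q : ℂ} (hq : IsGeneric q) (n : ℕ) : qInt q (n + 1) ≠ 0 := by
  refine div_ne_zero (fun h => hq.pow_ne_one (2 * (n + 1)) (by omega) ?_) hq.sub_inv_ne_zero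
  rw [sub_eq_zero, inv_pow] at h
  rw [two_mul, pow_add]
  nth_rewrite 1 [h]
  exact inv_mul_cancel₀ (pow_ne_zero _ hq.ne_zero)

/-! ### The operators on monomials -/

/-- The truncated exponent `c - 1` is harmless: at `c = 0` the factor `qInt q c` is zero. The same
holds for the truncated exponents in the formulas for the other operators. -/
theorem opE_mon (q : ℂ) (a b c : ℕ) : opE q (mon a b c) =
    (qInt q 2 * (q ^ 2 * q ^ (2 * b) * q ^ (c - 1) * qInt q c)) • mon (a + 1) b (c - 1) +
      qInt q 2 • mon a (b + 1) (c + 1) := by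
  simp only [opE, mon, LinearMap.smul_apply, LinearMap.add_apply, TensorProduct.map_tmul, gam_pow,
    Module.End.mul_apply, mu_zero_xmon, mu_one_xmon, mu_ymon, gam_one_xmon, gam_ymon, der_ymon,
    map_smul, ← TensorProduct.smul_tmul', TensorProduct.tmul_smul, smul_add, smul_smul]
  congr 2
  ring

theorem opF_mon (q : ℂ) (a b c : ℕ) : opF q (mon a b c) =
    qInt (q ^ 2) a • mon (a - 1) b (c + 1) -
      (q⁻¹ ^ (2 * a) * q ^ (c - 1) * qInt (q ^ 2) b * qInt q c) • mon a (b - 1) (c - 1) := by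
  simp only [opF, mon, LinearMap.sub_apply, TensorProduct.map_tmul, gam_pow,
    Module.End.mul_apply, der_zero_xmon, der_one_xmon, mu_ymon, gam_zero_xmon, gam_ymon, der_ymon,
    map_smul, ← TensorProduct.smul_tmul', TensorProduct.tmul_smul, smul_smul]
  congr 2
  ring

theorem opK_mon (q : ℂ) (a b c : ℕ) :
    opK q (mon a b c) = q ^ (2 * (a + b) + 2) • mon a b c := by
  simp only [opK, mon, LinearMap.smul_apply, TensorProduct.map_tmul, gam_pow,
    Module.End.mul_apply, gam_zero_xmon, gam_one_xmon, Module.End.one_apply,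
    map_smul, ← TensorProduct.smul_tmul', smul_smul]
  congr 1
  ring

section sigmaDelta
variable (q : ℂ) (hq : IsGeneric q)

theorem sigma_gen (g : Gen) : sigma q hq (Uq.gen q g) =
    match g with
    | .e => opE q
    | .f => opF q
    | .k => opK q
    | .kinv => opKInv q := Uq.lift_gen ..

theorem sigmaDelta_e : sigmaDelta q hq (Uq.e (q ^ 2)) =
    TensorProduct.map (Ew q) (Ks q) + TensorProduct.map 1 (Es q) := by
  simp [sigmaDelta, Uq.comul, Uq.lift_gen, sigmaW, sigmaS, Module.endTensorEndAlgHom_apply]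
  rfl

theorem sigmaDelta_f : sigmaDelta q hq (Uq.f (q ^ 2)) =
    TensorProduct.map (Fw q) 1 + TensorProduct.map (KwInv q) (Fs q) := by
  simp [sigmaDelta, Uq.comul, Uq.lift_gen, sigmaW, sigmaS, Module.endTensorEndAlgHom_apply]
  rfl

theorem sigmaDelta_k : sigmaDelta q hq (Uq.k (q ^ 2)) =
    TensorProduct.map (Kw q) (Ks q) := by
  simp [sigmaDelta, Uq.comul, Uq.lift_gen, sigmaW, sigmaS, Module.endTensorEndAlgHom_apply]
  rfl

theorem sigmaDelta_e_mon (a b c : ℕ) : sigmaDelta q hq (Uq.e (q ^ 2)) (mon a b c) =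
    (q * q ^ (2 * c) * qInt (q ^ 2) b) • mon (a + 1) (b - 1) c +
      (qInt q 2)⁻¹ • mon a b (c + 2) := by
  rw [sigmaDelta_e]
  simp only [mon, LinearMap.add_apply, LinearMap.smul_apply, TensorProduct.map_tmul, gam_pow,
    pow_two (mu 0), Ew, Ks, Es, Module.End.mul_apply, Module.End.one_apply, mu_zero_xmon, mu_ymon,
    der_one_xmon, gam_ymon, map_smul, ← TensorProduct.smul_tmul', TensorProduct.tmul_smul,
    smul_smul]
  congr 2
  ring

theorem sigmaDelta_f_mon (a b c : ℕ) : sigmaDelta q hq (Uq.f (q ^ 2)) (mon a b c) =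
    qInt (q ^ 2) a • mon (a - 1) (b + 1) c -
      (q⁻¹ ^ (2 * a) * q ^ (2 * b) * (qInt q 2)⁻¹ * qInt q c * qInt q (c - 1)) •
        mon a b (c - 2) := by
  rw [sigmaDelta_f]
  simp only [mon, LinearMap.add_apply, LinearMap.smul_apply, TensorProduct.map_tmul, gam_pow,
    pow_two (der q 0), Fw, KwInv, Fs, Module.End.mul_apply, Module.End.one_apply, mu_one_xmon,
    der_zero_xmon, der_ymon, gam_zero_xmon, gam_one_xmon, map_smul, ← TensorProduct.smul_tmul',
    TensorProduct.tmul_smul, smul_smul, sub_eq_add_neg, Nat.sub_sub, neg_mul, neg_smul,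
    TensorProduct.tmul_neg]
  congr 3
  ring

theorem sigmaDelta_k_mon (a b c : ℕ) : sigmaDelta q hq (Uq.k (q ^ 2)) (mon a b c) =
    (q ^ (2 * a + 1 + 2 * c) * q⁻¹ ^ (2 * b)) • mon a b c := by
  rw [sigmaDelta_k]
  simp only [mon, LinearMap.smul_apply, TensorProduct.map_tmul, gam_pow, Kw, Ks,
    Module.End.mul_apply, gam_zero_xmon, gam_one_xmon, gam_ymon, map_smul,
    ← TensorProduct.smul_tmul', TensorProduct.tmul_smul, smul_smul]
  congr 1
  ring

end sigmaDelta

/-! ### The two actions commute -/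

section commute
variable (q : ℂ) (hq : IsGeneric q)

theorem commute_e_opF : Commute (sigmaDelta q hq (Uq.e (q ^ 2))) (opF q) := by
  have h0 := hq.ne_zero
  have hs := hq.sub_inv_ne_zero
  have hs2 : q ^ 2 - 1 ≠ 0 := sub_ne_zero.2 (hq.pow_ne_one 2 (by norm_num))
  have ht : q ^ 4 - 1 ≠ 0 := sub_ne_zero.2 (hq.pow_ne_one 4 (by norm_num))
  have hu : q ^ 2 + 1 ≠ 0 := fun h => ht (by linear_combination (q ^ 2 - 1) * h)
  have hn : ∀ n, n + 2 - 1 = n + 1 := fun n => rfl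
  refine mon_ext fun a b c => ?_
  simp only [Module.End.mul_apply, opF_mon, sigmaDelta_e_mon, map_add, map_sub, map_smul]
  rw [qInt_two hq]
  -- Splitting off small exponents removes every truncated subtraction; what is left is one identity
  -- per monomial, rational in `q` and the powers `q^a`, `q^b`, `q^c`.
  rcases a with _ | a <;> rcases b with _ | _ | b <;> rcases c with _ | c <;>
    simp only [qInt_zero, mul_zero, zero_mul, zero_smul, smul_zero, add_zero, zero_add, sub_zero,
      zero_sub, Nat.add_sub_cancel, hn] <;>
    match_scalars <;> simp only [qInt, pow_add, pow_mul, inv_pow] <;> field_simp <;> ring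

theorem commute_f_opF : Commute (sigmaDelta q hq (Uq.f (q ^ 2))) (opF q) := by
  have h0 := hq.ne_zero
  have hs := hq.sub_inv_ne_zero
  have hs2 : q ^ 2 - 1 ≠ 0 := sub_ne_zero.2 (hq.pow_ne_one 2 (by norm_num))
  have ht : q ^ 4 - 1 ≠ 0 := sub_ne_zero.2 (hq.pow_ne_one 4 (by norm_num))
  have hu : q ^ 2 + 1 ≠ 0 := fun h => ht (by linear_combination (q ^ 2 - 1) * h)
  have hn : ∀ n, n + 2 - 1 = n + 1 := fun n => rfl
  have hn' : ∀ n, n + 1 - 2 = n - 1 := fun n => rfl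
  refine mon_ext fun a b c => ?_
  simp only [Module.End.mul_apply, opF_mon, sigmaDelta_f_mon, map_sub, map_smul]
  rw [qInt_two hq]
  rcases a with _ | _ | a <;> rcases b with _ | b <;> rcases c with _ | _ | _ | c <;>
    simp only [qInt_zero, mul_zero, zero_mul, zero_smul, smul_zero, zero_add, sub_zero,
      zero_sub, Nat.add_sub_cancel, hn, hn'] <;>
    match_scalars <;> simp only [qInt, pow_add, pow_mul, inv_pow] <;> field_simp <;> ring

theorem commute_e_opE : Commute (sigmaDelta q hq (Uq.e (q ^ 2))) (opE q) := by
  have h0 := hq.ne_zero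
  have hs := hq.sub_inv_ne_zero
  have hs2 : q ^ 2 - 1 ≠ 0 := sub_ne_zero.2 (hq.pow_ne_one 2 (by norm_num))
  have ht : q ^ 4 - 1 ≠ 0 := sub_ne_zero.2 (hq.pow_ne_one 4 (by norm_num))
  have hu : q ^ 2 + 1 ≠ 0 := fun h => ht (by linear_combination (q ^ 2 - 1) * h)
  have hn : ∀ n, n + 2 - 1 = n + 1 := fun n => rfl
  refine mon_ext fun a b c => ?_
  simp only [Module.End.mul_apply, opE_mon, sigmaDelta_e_mon, map_add, map_smul]
  rw [qInt_two hq]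
  rcases b with _ | b <;> rcases c with _ | c <;>
    simp only [qInt_zero, mul_zero, zero_smul, zero_add,
      Nat.add_sub_cancel, hn] <;>
    match_scalars <;> (try simp only [qInt, pow_add, pow_mul, inv_pow]) <;>
      field_simp <;> ring

theorem commute_f_opE : Commute (sigmaDelta q hq (Uq.f (q ^ 2))) (opE q) := by
  have h0 := hq.ne_zero
  have hs := hq.sub_inv_ne_zero
  have hs2 : q ^ 2 - 1 ≠ 0 := sub_ne_zero.2 (hq.pow_ne_one 2 (by norm_num))
  have ht : q ^ 4 - 1 ≠ 0 := sub_ne_zero.2 (hq.pow_ne_one 4 (by norm_num))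
  have hu : q ^ 2 + 1 ≠ 0 := fun h => ht (by linear_combination (q ^ 2 - 1) * h)
  have hn : ∀ n, n + 2 - 1 = n + 1 := fun n => rfl
  have hn' : ∀ n, n + 1 - 2 = n - 1 := fun n => rfl
  refine mon_ext fun a b c => ?_
  simp only [Module.End.mul_apply, opE_mon, sigmaDelta_f_mon, map_add, map_sub, map_smul]
  rw [qInt_two hq]
  rcases a with _ | a <;> rcases c with _ | _ | _ | c <;>
    simp only [qInt_zero, mul_zero, zero_mul, zero_smul, zero_add, sub_zero,
      zero_sub, Nat.add_sub_cancel, hn, hn'] <;>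
    match_scalars <;> simp only [qInt, pow_add, pow_mul, inv_pow] <;> field_simp <;> ring

/-- The `k`-weight of a monomial is `q^(2(a - b + c) + 1)`, and both terms of `E` preserve `a - b +
c`. The same is true of `F`. -/
theorem commute_k_opE : Commute (sigmaDelta q hq (Uq.k (q ^ 2))) (opE q) := by
  have h0 := hq.ne_zero
  refine mon_ext fun a b c => ?_
  simp only [Module.End.mul_apply, opE_mon, sigmaDelta_k_mon, map_add, map_smul, smul_add,
    smul_smul]
  congr 2
  · rcases c with _ | c
    · simp [qInt_zero]
    · rw [Nat.add_sub_cancel]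
      ring
  · simp only [inv_pow]
    field_simp
    ring

theorem commute_k_opF : Commute (sigmaDelta q hq (Uq.k (q ^ 2))) (opF q) := by
  have h0 := hq.ne_zero
  refine mon_ext fun a b c => ?_
  simp only [Module.End.mul_apply, opF_mon, sigmaDelta_k_mon, map_sub, map_smul, smul_sub,
    smul_smul]
  congr 2
  · rcases a with _ | a
    · simp [qInt_zero]
    · rw [Nat.add_sub_cancel]
      ring
  · rcases b with _ | b
    · simp [qInt_zero]
    · rcases c with _ | c
      · simp [qInt_zero]
      · simp only [Nat.add_sub_cancel, inv_pow]
        field_simp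
        ring

theorem commute_of_mul_eq_one {A : Type*} [Monoid A] {x y y' : A} (h : Commute x y)
    (h₁ : y * y' = 1) (h₂ : y' * y = 1) : Commute x y' := by
  change x * y' = y' * x
  calc x * y' = y' * y * x * y' := by rw [h₂, one_mul]
    _ = y' * (x * y) * y' := by rw [mul_assoc y', h.eq]
    _ = y' * x := by rw [mul_assoc, mul_assoc, h₁, mul_one]

/-- To commute with the image of `U_q(sl₂)` it suffices to commute with `e`, `f`, `k`. -/
theorem commute_of_gen {A : Type*} [Semiring A] [Algebra ℂ A] {q : ℂ} (ρ : Uq q →ₐ[ℂ] A) {x : A}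
    (he : Commute x (ρ (Uq.e q))) (hf : Commute x (ρ (Uq.f q))) (hk : Commute x (ρ (Uq.k q)))
    (u : Uq q) : Commute x (ρ u) := by
  induction u using Uq.induction with
  | scalar c => rw [AlgHom.commutes]; exact (Algebra.commutes c x).symm
  | mul u v hu hv => rw [map_mul]; exact hu.mul_right hv
  | add u v hu hv => rw [map_add]; exact hu.add_right hv
  | gen g =>
    cases g with
    | e => exact he
    | f => exact hf
    | k => exact hk
    | kinv =>
      exact commute_of_mul_eq_one hk (by rw [← map_mul, Uq.k_mul_kinv, map_one])
        (by rw [← map_mul, Uq.kinv_mul_k, map_one])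

theorem commute_sigmaDelta_opE (u : Uq (q ^ 2)) : Commute (sigmaDelta q hq u) (opE q) :=
  (commute_of_gen (sigmaDelta q hq) (commute_e_opE q hq).symm (commute_f_opE q hq).symm
    (commute_k_opE q hq).symm u).symm

theorem commute_sigmaDelta_opF (u : Uq (q ^ 2)) : Commute (sigmaDelta q hq u) (opF q) :=
  (commute_of_gen (sigmaDelta q hq) (commute_e_opF q hq).symm (commute_f_opF q hq).symm
    (commute_k_opF q hq).symm u).symm

/-- `K` sees only the total degree `a + b`, which `U_{q²}` preserves. -/
theorem commute_sigmaDelta_opK (u : Uq (q ^ 2)) : Commute (sigmaDelta q hq u) (opK q) := by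
  refine (commute_of_gen (sigmaDelta q hq) ?_ ?_ ?_ u).symm
  · refine mon_ext fun a b c => ?_
    rcases b with _ | b
    · simp [opK_mon, sigmaDelta_e_mon, qInt_zero, smul_smul, mul_comm]
    · simp only [Module.End.mul_apply, opK_mon, sigmaDelta_e_mon, map_add, map_smul, smul_add,
        smul_smul, Nat.add_sub_cancel, add_right_comm a 1 b, add_assoc a b 1, mul_comm]
  · refine mon_ext fun a b c => ?_
    rcases a with _ | a
    · simp [opK_mon, sigmaDelta_f_mon, qInt_zero, smul_smul, mul_comm]
    · simp only [Module.End.mul_apply, opK_mon, sigmaDelta_f_mon, map_sub, map_smul, smul_sub,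
        smul_smul, Nat.add_sub_cancel, add_right_comm a 1 b, add_assoc a b 1, mul_comm]
  · refine mon_ext fun a b c => ?_
    simp only [Module.End.mul_apply, opK_mon, sigmaDelta_k_mon, map_smul, smul_smul, mul_comm]

theorem commute_sigmaDelta_sigma (u : Uq (q ^ 2)) (v : Uq q) :
    Commute (sigmaDelta q hq u) (sigma q hq v) := by
  refine commute_of_gen (sigma q hq) ?_ ?_ ?_ v
  · rw [sigma_gen]; exact commute_sigmaDelta_opE q hq u
  · rw [sigma_gen]; exact commute_sigmaDelta_opF q hq u
  · rw [sigma_gen]; exact commute_sigmaDelta_opK q hq u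

end commute

/-! ### Coefficients -/

/-- The coefficient of `x₁ ^ a x₂ ^ b y ^ c`. -/
def coef (a b c : ℕ) : PS →ₗ[ℂ] ℂ := monBasis.coord (a, b, c)

theorem coef_mon (a b c a' b' c' : ℕ) :
    coef a b c (mon a' b' c') = if a' = a ∧ b' = b ∧ c' = c then 1 else 0 := by
  rw [coef, ← monBasis_apply (a', b', c'), Module.Basis.coord_apply, Module.Basis.repr_self,
    Finsupp.single_apply]
  simp only [Prod.mk.injEq]

theorem eq_zero_of_coef {x : PS} (h : ∀ a b c, coef a b c x = 0) : x = 0 :=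
  monBasis.repr.map_eq_zero_iff.1 (Finsupp.ext fun i => h i.1 i.2.1 i.2.2)

/-- Exactly two monomials can contribute to a given one under `F`. On the kernel of `F` this becomes
a recursion that trades a factor `x₁` for `x₂ y²`. -/
theorem coef_opF_succ (q : ℂ) (a b c : ℕ) (x : PS) : coef a b (c + 1) (opF q x) =
    qInt (q ^ 2) (a + 1) * coef (a + 1) b c x -
      q⁻¹ ^ (2 * a) * q ^ (c + 1) * qInt (q ^ 2) (b + 1) * qInt q (c + 2) *
        coef a (b + 1) (c + 2) x := by
  suffices coef a b (c + 1) ∘ₗ opF q = qInt (q ^ 2) (a + 1) • coef (a + 1) b c -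
      (q⁻¹ ^ (2 * a) * q ^ (c + 1) * qInt (q ^ 2) (b + 1) * qInt q (c + 2)) •
        coef a (b + 1) (c + 2) from LinearMap.congr_fun this x
  refine mon_ext fun a' b' c' => ?_
  simp only [LinearMap.comp_apply, opF_mon, map_sub, map_smul, coef_mon, LinearMap.sub_apply,
    LinearMap.smul_apply, smul_eq_mul]
  congr 1
  · rcases a' with _ | a'
    · simp [qInt_zero]
    · by_cases h : a' = a ∧ b' = b ∧ c' = c
      · obtain ⟨rfl, rfl, rfl⟩ := h; simp
      · rw [if_neg (by omega), if_neg (by omega), mul_zero, mul_zero]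
  · rcases b' with _ | b'
    · simp [qInt_zero]
    · rcases c' with _ | c'
      · simp [qInt_zero]
      · by_cases h : a' = a ∧ b' = b ∧ c' = c + 1
        · obtain ⟨rfl, rfl, rfl⟩ := h; simp
        · rw [if_neg (by omega), if_neg (by omega), mul_zero, mul_zero]

/-- The first term of `F` multiplies by `y` and never reaches `y^0`. The recursion degenerates to a
single term here, the source of the vanishing of low odd coefficients. -/
theorem coef_opF_zero (q : ℂ) (a b : ℕ) (x : PS) : coef a b 0 (opF q x) =
    -(q⁻¹ ^ (2 * a) * qInt (q ^ 2) (b + 1) * qInt q 1 * coef a (b + 1) 1 x) := by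
  suffices coef a b 0 ∘ₗ opF q =
      -((q⁻¹ ^ (2 * a) * qInt (q ^ 2) (b + 1) * qInt q 1) • coef a (b + 1) 1) from
    LinearMap.congr_fun this x
  refine mon_ext fun a' b' c' => ?_
  simp only [LinearMap.comp_apply, opF_mon, map_sub, map_smul, coef_mon, LinearMap.neg_apply,
    LinearMap.smul_apply, smul_eq_mul]
  rw [if_neg (by omega), mul_zero, zero_sub]
  congr 1
  rcases b' with _ | b'
  · simp [qInt_zero]
  · rcases c' with _ | c'
    · simp [qInt_zero]
    · by_cases h : a' = a ∧ b' = b ∧ c' = 0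
      · obtain ⟨rfl, rfl, rfl⟩ := h; simp
      · rw [if_neg (by omega), if_neg (by omega), mul_zero, mul_zero]

/-- The part of `e` acting on the polynomial factor produces a factor `x₁`, so at `x₁ = 0` only
multiplication by `y² / [2]_q` survives. -/
theorem coef_zero_sigmaDelta_e (q : ℂ) (hq : IsGeneric q) (b c : ℕ) (x : PS) :
    coef 0 b c (sigmaDelta q hq (Uq.e (q ^ 2)) x) =
      if 2 ≤ c then (qInt q 2)⁻¹ * coef 0 b (c - 2) x else 0 := by
  have key : ∀ x, coef 0 b c (sigmaDelta q hq (Uq.e (q ^ 2)) x) =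
      ((if 2 ≤ c then (qInt q 2)⁻¹ else 0) • coef 0 b (c - 2)) x := by
    intro x
    refine LinearMap.congr_fun (f := coef 0 b c ∘ₗ sigmaDelta q hq (Uq.e (q ^ 2)))
      (mon_ext fun a' b' c' => ?_) x
    simp only [LinearMap.comp_apply, sigmaDelta_e_mon, map_add, map_smul, coef_mon,
      LinearMap.smul_apply, smul_eq_mul]
    rw [if_neg (fun h => by omega), mul_zero, zero_add]
    by_cases h : a' = 0 ∧ b' = b ∧ c' + 2 = c
    · obtain ⟨rfl, rfl, rfl⟩ := h; simp
    · rw [if_neg h, mul_zero]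
      by_cases hc : 2 ≤ c
      · rw [if_pos hc, if_neg (by omega), mul_zero]
      · rw [if_neg hc, zero_mul]
  rw [key, LinearMap.smul_apply, smul_eq_mul, ite_mul, zero_mul]

theorem coef_zero_sigmaDelta_f (q : ℂ) (hq : IsGeneric q) (b c : ℕ) (x : PS) :
    coef 0 (b + 1) c (sigmaDelta q hq (Uq.f (q ^ 2)) x) = qInt (q ^ 2) 1 * coef 1 b c x -
      q ^ (2 * (b + 1)) * (qInt q 2)⁻¹ * qInt q (c + 2) * qInt q (c + 1) *
        coef 0 (b + 1) (c + 2) x := by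
  suffices coef 0 (b + 1) c ∘ₗ sigmaDelta q hq (Uq.f (q ^ 2)) = qInt (q ^ 2) 1 • coef 1 b c -
      (q ^ (2 * (b + 1)) * (qInt q 2)⁻¹ * qInt q (c + 2) * qInt q (c + 1)) •
        coef 0 (b + 1) (c + 2) from LinearMap.congr_fun this x
  refine mon_ext fun a' b' c' => ?_
  simp only [LinearMap.comp_apply, sigmaDelta_f_mon, map_sub, map_smul, coef_mon,
    LinearMap.sub_apply, LinearMap.smul_apply, smul_eq_mul]
  congr 1
  · rcases a' with _ | a'
    · simp [qInt_zero]
    · by_cases h : a' = 0 ∧ b' = b ∧ c' = c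
      · obtain ⟨rfl, rfl, rfl⟩ := h; simp
      · rw [if_neg (by omega), if_neg (by omega), mul_zero, mul_zero]
  · rcases c' with _ | _ | c'
    · simp [qInt_zero]
    · simp [qInt_zero]
    · by_cases h : a' = 0 ∧ b' = b + 1 ∧ c' = c
      · obtain ⟨rfl, rfl, rfl⟩ := h; simp
      · rw [if_neg (by omega), if_neg (by omega), mul_zero, mul_zero]

/-! ### Degrees and parity -/

theorem homogeneousSubmodule_eq_span (d : ℕ) : MvPolynomial.homogeneousSubmodule (Fin 2) ℂ d =
    Submodule.span ℂ ((fun i : ℕ × ℕ => xmon i.1 i.2) '' {i | i.1 + i.2 = d}) := by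
  have h : (fun i : ℕ × ℕ => xmon i.1 i.2) '' {i | i.1 + i.2 = d} =
      MvPolynomial.basisMonomials (Fin 2) ℂ '' {α | α.degree = d} := by
    ext p
    constructor
    · rintro ⟨i, hi, rfl⟩
      refine ⟨expEquiv.symm i, ?_, by simp [xmon]⟩
      simpa [Finsupp.degree_eq_sum, expEquiv] using hi
    · rintro ⟨α, hα, rfl⟩
      refine ⟨expEquiv α, ?_, by simp [xmon]⟩
      simpa [Finsupp.degree_eq_sum, expEquiv] using hα
  ext p
  rw [h, Module.Basis.mem_span_image, MvPolynomial.mem_homogeneousSubmodule]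
  constructor
  · intro hp α hα
    change α.degree = d
    rw [Finsupp.degree_eq_weight_one]
    exact hp (Finsupp.mem_support_iff.1 hα)
  · intro hp α hα
    have : α.degree = d := hp (Finsupp.mem_support_iff.2 hα)
    rwa [Finsupp.degree_eq_weight_one] at this

/-- Both tensor factors are spanned by monomials, so membership is a condition on the support in the
monomial basis. -/
theorem mem_degTensor {T : Submodule ℂ (P 1)} {C : Set ℕ}
    (hT : T = Submodule.span ℂ (ymon '' C)) {d : ℕ} {x : PS} :
    x ∈ degTensor d T ↔ ∀ a b c, coef a b c x ≠ 0 → a + b = d ∧ c ∈ C := by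
  have h : degTensor d T = Submodule.span ℂ (monBasis '' {i | i.1 + i.2.1 = d ∧ i.2.2 ∈ C}) := by
    rw [degTensor, TensorProduct.range_mapIncl, homogeneousSubmodule_eq_span, hT,
      Submodule.map₂_span_span]
    congr 1
    ext p
    constructor
    · rintro ⟨_, ⟨i, hi, rfl⟩, _, ⟨c, hc, rfl⟩, rfl⟩
      exact ⟨(i.1, i.2, c), ⟨hi, hc⟩, monBasis_apply _⟩
    · rintro ⟨i, ⟨hi, hc⟩, rfl⟩
      exact ⟨_, ⟨(i.1, i.2.1), hi, rfl⟩, _, ⟨i.2.2, hc, rfl⟩, (monBasis_apply _).symm⟩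
  rw [h, Module.Basis.mem_span_image]
  constructor
  · intro hx a b c hc
    exact hx (Finsupp.mem_support_iff.2 hc)
  · intro hx i hi
    exact hx i.1 i.2.1 i.2.2 (Finsupp.mem_support_iff.1 hi)

theorem X_pow_eq_ymon (n : ℕ) : (MvPolynomial.X 0 : P 1) ^ n = ymon n := by
  rw [MvPolynomial.X_pow_eq_monomial, ymon]
  refine congrArg (fun s => MvPolynomial.monomial s (1 : ℂ)) ?_
  ext
  exact Finsupp.single_eq_same

theorem SPlus_eq : SPlus = Submodule.span ℂ (ymon '' {c | Even c}) := by
  rw [SPlus]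
  congr 1
  ext p
  constructor
  · rintro ⟨n, rfl⟩
    exact ⟨2 * n, even_two_mul n, (X_pow_eq_ymon _).symm⟩
  · rintro ⟨c, ⟨n, rfl⟩, rfl⟩
    exact ⟨n, by rw [← X_pow_eq_ymon, ← two_mul]⟩

theorem SMinus_eq : SMinus = Submodule.span ℂ (ymon '' {c | Odd c}) := by
  rw [SMinus]
  congr 1
  ext p
  constructor
  · rintro ⟨n, rfl⟩
    exact ⟨2 * n + 1, ⟨n, rfl⟩, (X_pow_eq_ymon _).symm⟩
  · rintro ⟨c, ⟨n, rfl⟩, rfl⟩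
    exact ⟨n, X_pow_eq_ymon _⟩

theorem top_eq_span_ymon : (⊤ : Submodule ℂ (P 1)) = Submodule.span ℂ (ymon '' Set.univ) := by
  rw [← (MvPolynomial.basisMonomials (Fin 1) ℂ).span_eq, Set.image_univ]
  congr 1
  rw [MvPolynomial.coe_basisMonomials]
  exact (expEquiv₁.symm.surjective.range_comp fun s => MvPolynomial.monomial s (1 : ℂ)).symm

theorem mem_PSdeg {d : ℕ} {x : PS} : x ∈ PSdeg d ↔ ∀ a b c, coef a b c x ≠ 0 → a + b = d := by
  simpa [PSdeg] using mem_degTensor top_eq_span_ymon (d := d) (x := x)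

theorem coef_opK (q : ℂ) (a b c : ℕ) (x : PS) :
    coef a b c (opK q x) = q ^ (2 * (a + b) + 2) * coef a b c x := by
  suffices coef a b c ∘ₗ opK q = q ^ (2 * (a + b) + 2) • coef a b c from
    LinearMap.congr_fun this x
  refine mon_ext fun a' b' c' => ?_
  simp only [LinearMap.comp_apply, opK_mon, map_smul, coef_mon, LinearMap.smul_apply, smul_eq_mul]
  by_cases h : a' = a ∧ b' = b ∧ c' = c
  · obtain ⟨rfl, rfl, rfl⟩ := h; rfl
  · rw [if_neg h, mul_zero, mul_zero]

theorem ext_coef {x y : PS} (h : ∀ a b c, coef a b c x = coef a b c y) : x = y :=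
  monBasis.repr.injective (Finsupp.ext fun i => h i.1 i.2.1 i.2.2)

/-- The degree is detected by the action of `K`. -/
theorem mem_PSdeg_iff_opK {q : ℂ} (hq : IsGeneric q) {d : ℕ} {x : PS} :
    x ∈ PSdeg d ↔ opK q x = q ^ (2 * d + 2) • x := by
  rw [mem_PSdeg]
  constructor
  · intro h
    refine ext_coef fun a b c => ?_
    rw [coef_opK, map_smul, smul_eq_mul]
    by_cases hc : coef a b c x = 0
    · rw [hc, mul_zero, mul_zero]
    · rw [h a b c hc]
  · intro h a b c hc
    have h1 := coef_opK q a b c x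
    rw [h, map_smul, smul_eq_mul] at h1
    have := hq.pow_injective (mul_right_cancel₀ hc h1)
    omega

/-- The parity operator `y ↦ -y`. -/
def parity : Module.End ℂ PS := TensorProduct.map 1 (gam (-1) 0)

theorem parity_mon (a b c : ℕ) : parity (mon a b c) = (-1 : ℂ) ^ c • mon a b c := by
  rw [parity, mon, TensorProduct.map_tmul, gam_ymon, TensorProduct.tmul_smul,
    Module.End.one_apply]

theorem coef_parity (a b c : ℕ) (x : PS) :
    coef a b c (parity x) = (-1) ^ c * coef a b c x := by
  suffices coef a b c ∘ₗ parity = (-1 : ℂ) ^ c • coef a b c from LinearMap.congr_fun this x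
  refine mon_ext fun a' b' c' => ?_
  simp only [LinearMap.comp_apply, parity_mon, map_smul, coef_mon, LinearMap.smul_apply,
    smul_eq_mul]
  by_cases h : a' = a ∧ b' = b ∧ c' = c
  · obtain ⟨rfl, rfl, rfl⟩ := h; rfl
  · rw [if_neg h, mul_zero, mul_zero]

/-- Each term of `F` changes the degree in `y` by one, hence the sign. Thus `ker F` is stable under
parity and splits into an even and an odd half. -/
theorem opF_parity (q : ℂ) (x : PS) : opF q (parity x) = -parity (opF q x) := by
  suffices opF q ∘ₗ parity = -(parity ∘ₗ opF q) from LinearMap.congr_fun this x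
  refine mon_ext fun a b c => ?_
  simp only [LinearMap.comp_apply, LinearMap.neg_apply, parity_mon, map_smul, opF_mon, map_sub]
  rcases c with _ | c
  · simp only [qInt_zero, mul_zero, zero_smul, sub_zero, pow_zero, one_smul, zero_add,
      pow_one]
    module
  · rw [Nat.add_sub_cancel]
    simp only [pow_succ, mul_neg, neg_mul, mul_one, neg_neg, neg_smul, smul_smul,
      smul_sub, neg_sub]
    module

/-- The generators of `U_{q²}` change the degree in `y` by `0` or `±2`. -/
theorem commute_sigmaDelta_parity (q : ℂ) (hq : IsGeneric q) (u : Uq (q ^ 2)) :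
    Commute (sigmaDelta q hq u) parity := by
  refine (commute_of_gen (sigmaDelta q hq) ?_ ?_ ?_ u).symm
  · refine mon_ext fun a b c => ?_
    simp [parity_mon, sigmaDelta_e_mon, smul_smul, mul_comm, pow_add]
  · refine mon_ext fun a b c => ?_
    rcases c with _ | _ | c
    · simp [parity_mon, sigmaDelta_f_mon, qInt_zero]
    · simp only [Module.End.mul_apply, parity_mon, sigmaDelta_f_mon, map_smul, qInt_zero,
        mul_zero, zero_smul, sub_zero, zero_add, Nat.sub_self]
      exact smul_comm _ _ _
    · simp [parity_mon, sigmaDelta_f_mon, smul_smul, mul_comm, pow_succ, smul_sub]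
  · refine mon_ext fun a b c => ?_
    simp [parity_mon, sigmaDelta_k_mon, smul_smul, mul_comm]

theorem mem_degTensor_SPlus {d : ℕ} {x : PS} :
    x ∈ degTensor d SPlus ↔ x ∈ PSdeg d ∧ parity x = x := by
  rw [mem_degTensor SPlus_eq, mem_PSdeg]
  constructor
  · refine fun h => ⟨fun a b c hc => (h a b c hc).1, ext_coef fun a b c => ?_⟩
    rw [coef_parity]
    by_cases hc : coef a b c x = 0
    · rw [hc, mul_zero]
    · rw [Even.neg_one_pow (h a b c hc).2, one_mul]
  · rintro ⟨h, hp⟩ a b c hc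
    refine ⟨h a b c hc, ?_⟩
    by_contra hodd
    have := coef_parity a b c x
    rw [hp, Odd.neg_one_pow (Nat.not_even_iff_odd.1 hodd)] at this
    exact hc (by linear_combination this / 2)

theorem mem_degTensor_SMinus {d : ℕ} {x : PS} :
    x ∈ degTensor d SMinus ↔ x ∈ PSdeg d ∧ parity x = -x := by
  rw [mem_degTensor SMinus_eq, mem_PSdeg]
  constructor
  · refine fun h => ⟨fun a b c hc => (h a b c hc).1, ext_coef fun a b c => ?_⟩
    rw [coef_parity, map_neg]
    by_cases hc : coef a b c x = 0
    · rw [hc, mul_zero, neg_zero]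
    · rw [Odd.neg_one_pow (h a b c hc).2, neg_one_mul]
  · rintro ⟨h, hp⟩ a b c hc
    refine ⟨h a b c hc, ?_⟩
    by_contra heven
    have := coef_parity a b c x
    rw [hp, Even.neg_one_pow (Nat.not_odd_iff_even.1 heven), map_neg] at this
    exact hc (by linear_combination -this / 2)

theorem mem_MonoPlus {q : ℂ} {d : ℕ} {x : PS} :
    x ∈ MonoPlus q d ↔ x ∈ Mono q d ∧ parity x = x := by
  rw [MonoPlus, Submodule.mem_inf, mem_degTensor_SPlus, Mono, Submodule.mem_inf, and_assoc]

theorem mem_MonoMinus {q : ℂ} {d : ℕ} {x : PS} :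
    x ∈ MonoMinus q d ↔ x ∈ Mono q d ∧ parity x = -x := by
  rw [MonoMinus, Submodule.mem_inf, mem_degTensor_SMinus, Mono, Submodule.mem_inf, and_assoc]

theorem parity_parity (x : PS) : parity (parity x) = x :=
  ext_coef fun a b c => by
    rw [coef_parity, coef_parity, ← mul_assoc, ← mul_pow]
    simp

theorem parity_mem_Mono {q : ℂ} {d : ℕ} {x : PS} (hx : x ∈ Mono q d) : parity x ∈ Mono q d := by
  rw [Mono, Submodule.mem_inf, LinearMap.mem_ker] at hx ⊢
  refine ⟨by rw [opF_parity, hx.1, map_zero, neg_zero], mem_PSdeg.2 fun a b c hc => ?_⟩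
  rw [coef_parity] at hc
  exact mem_PSdeg.1 hx.2 a b c (right_ne_zero_of_mul hc)

theorem disjoint_MonoPlus_MonoMinus (q : ℂ) (d : ℕ) :
    Disjoint (MonoPlus q d) (MonoMinus q d) := by
  rw [Submodule.disjoint_def]
  intro x hp hm
  have h := (mem_MonoPlus.1 hp).2.symm.trans (mem_MonoMinus.1 hm).2
  have h2 : x = (2 : ℂ)⁻¹ • (x + x) := by module
  rw [h2]
  nth_rewrite 1 [h]
  rw [neg_add_cancel, smul_zero]

theorem MonoPlus_sup_MonoMinus (q : ℂ) (d : ℕ) : MonoPlus q d ⊔ MonoMinus q d = Mono q d := by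
  refine le_antisymm (sup_le (fun x hx => (mem_MonoPlus.1 hx).1)
    fun x hx => (mem_MonoMinus.1 hx).1) fun x hx => ?_
  have h : x = (2 : ℂ)⁻¹ • (x + parity x) + (2 : ℂ)⁻¹ • (x - parity x) := by module
  rw [h]
  refine Submodule.add_mem_sup (Submodule.smul_mem _ _ (mem_MonoPlus.2 ⟨?_, ?_⟩))
    (Submodule.smul_mem _ _ (mem_MonoMinus.2 ⟨?_, ?_⟩))
  · exact Submodule.add_mem _ hx (parity_mem_Mono hx)
  · rw [map_add, parity_parity, add_comm]
  · exact Submodule.sub_mem _ hx (parity_mem_Mono hx)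
  · rw [map_sub, parity_parity, neg_sub]

/-! ### The symplectic monogenics as a module -/

section monogenics
variable {q : ℂ} {d : ℕ} {x : PS}

theorem mem_Mono : x ∈ Mono q d ↔ opF q x = 0 ∧ x ∈ PSdeg d := by
  rw [Mono, Submodule.mem_inf, LinearMap.mem_ker]

theorem sigmaDelta_mem_PSdeg (hq : IsGeneric q) (u : Uq (q ^ 2)) (hx : x ∈ PSdeg d) :
    sigmaDelta q hq u x ∈ PSdeg d := by
  rw [mem_PSdeg_iff_opK hq] at hx ⊢
  rw [← Module.End.mul_apply, ← (commute_sigmaDelta_opK q hq u).eq, Module.End.mul_apply, hx,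
    map_smul]

theorem sigmaDelta_mem_Mono (hq : IsGeneric q) (u : Uq (q ^ 2)) (hx : x ∈ Mono q d) :
    sigmaDelta q hq u x ∈ Mono q d := by
  rw [mem_Mono] at hx ⊢
  refine ⟨?_, sigmaDelta_mem_PSdeg hq u hx.2⟩
  rw [← Module.End.mul_apply, ← (commute_sigmaDelta_opF q hq u).eq, Module.End.mul_apply, hx.1,
    map_zero]

theorem parity_sigmaDelta (hq : IsGeneric q) (u : Uq (q ^ 2)) (x : PS) :
    parity (sigmaDelta q hq u x) = sigmaDelta q hq u (parity x) :=
  LinearMap.congr_fun (commute_sigmaDelta_parity q hq u).eq.symm x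

/-! ### Monogenics and their restriction to `x₁ = 0` -/

/-- A monogenic is determined by its restriction to `x₁ = 0`. -/
theorem Mono_eq_zero (hq : IsGeneric q) (hx : x ∈ Mono q d) (h : ∀ c, coef 0 d c x = 0) :
    x = 0 := by
  rw [mem_Mono, mem_PSdeg] at hx
  have key : ∀ a b c, a + b = d → coef a b c x = 0 := by
    intro a
    induction a with
    | zero => intro b c hb; obtain rfl : b = d := by omega
              exact h c
    | succ a ih =>
      intro b c hb
      -- This coefficient of `F x` contains `coef (a + 1) b c x` with factor `[a+1]_{q²} ≠ 0`, next
      -- to a coefficient with smaller exponent of `x₁`.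
      have h1 := coef_opF_succ q a b c x
      rw [hx.1, map_zero, ih (b + 1) (c + 2) (by omega), mul_zero, sub_zero] at h1
      exact (mul_eq_zero.1 h1.symm).resolve_left (qInt_succ_ne_zero hq.sq a)
  refine eq_zero_of_coef fun a b c => ?_
  by_contra hc
  exact hc (key a b c (hx.2 a b c hc))

/-- The odd coefficients of low degree in `y` vanish on monogenics. -/
theorem coef_Mono_odd (hq : IsGeneric q) (hx : opF q x = 0) (i a b : ℕ) (hi : i < b) :
    coef a b (2 * i + 1) x = 0 := by
  have hq0 := hq.ne_zero
  induction i generalizing a b with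
  | zero =>
    obtain ⟨b, rfl⟩ := Nat.exists_eq_succ_of_ne_zero hi.ne'
    have h1 := coef_opF_zero q a b x
    rw [hx, map_zero, zero_eq_neg] at h1
    refine (mul_eq_zero.1 h1).resolve_left ?_
    exact mul_ne_zero (mul_ne_zero (pow_ne_zero _ (inv_ne_zero hq0)) (qInt_succ_ne_zero hq.sq b))
      (qInt_succ_ne_zero hq 0)
  | succ i ih =>
    obtain ⟨b, rfl⟩ := Nat.exists_eq_succ_of_ne_zero (Nat.ne_of_gt (Nat.zero_lt_of_lt hi))
    -- The recursion is now read in the other direction: the coefficient with one more `x₁` vanishes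
    -- by induction, which forces the one with `x₂ y²` instead to vanish too.
    have h1 := coef_opF_succ q a b (2 * i + 1) x
    rw [hx, map_zero, ih (a + 1) b (by omega), mul_zero, zero_sub, zero_eq_neg] at h1
    refine (mul_eq_zero.1 h1).resolve_left ?_
    exact mul_ne_zero (mul_ne_zero (mul_ne_zero (pow_ne_zero _ (inv_ne_zero hq0))
      (pow_ne_zero _ hq0)) (qInt_succ_ne_zero hq.sq b)) (qInt_succ_ne_zero hq _)

/-- At `x₁ = 0` the vectors `e^k w` are nonzero multiples of `x₂^d y^(c₀ + 2k)`, one for each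
admissible power of `y`. -/
theorem coef_sigmaDelta_e_pow (hq : IsGeneric q) {c₀ : ℕ} {w : PS}
    (hw : ∀ c, coef 0 d c w = if c = c₀ then 1 else 0) (k c : ℕ) :
    coef 0 d c ((sigmaDelta q hq (Uq.e (q ^ 2)) ^ k) w) =
      if c = c₀ + 2 * k then (qInt q 2)⁻¹ ^ k else 0 := by
  induction k generalizing c with
  | zero => simpa using hw c
  | succ k ih =>
    rw [pow_succ', Module.End.mul_apply, coef_zero_sigmaDelta_e, ih]
    by_cases hc : c = c₀ + 2 * (k + 1)
    · rw [if_pos hc, if_pos (by omega), if_pos (by omega), pow_succ']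
    · rw [if_neg hc]
      by_cases h2 : 2 ≤ c
      · rw [if_pos h2, if_neg (by omega), mul_zero]
      · rw [if_neg h2]

/-- Monogenics whose restriction to `x₁ = 0` has the shape of that of the `e ^ n w`. -/
theorem mem_span_of_coef (hq : IsGeneric q) {c₀ : ℕ} {w : PS} (hwM : w ∈ Mono q d)
    (hw : ∀ c, coef 0 d c w = if c = c₀ then 1 else 0) (hx : x ∈ Mono q d)
    (hxc : ∀ c, coef 0 d c x ≠ 0 → ∃ n, c = c₀ + 2 * n) :
    x ∈ Submodule.span ℂ (Set.range fun n : ℕ => (sigmaDelta q hq (Uq.e (q ^ 2)) ^ n) w) := by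
  set v : ℕ → PS := fun n => (sigmaDelta q hq (Uq.e (q ^ 2)) ^ n) w with hv
  have hvM : ∀ n, v n ∈ Mono q d := fun n => by
    rw [hv]
    simp only [← map_pow]
    exact sigmaDelta_mem_Mono hq _ hwM
  have h2 : qInt q 2 ≠ 0 := qInt_succ_ne_zero hq 1
  -- These are the coefficients of `x` at `x₂^d y^(c₀ + 2n)`. The factor `[2]_q^n` in `y` undoes the
  -- normalization of `e^n w`, so `x` and `y` agree at `x₁ = 0` and hence everywhere.
  let a : ℕ →₀ ℂ := (monBasis.repr x).comapDomain (fun n => (0, d, c₀ + 2 * n))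
    (fun m _ n _ h => by simpa using h)
  let y : PS := ∑ n ∈ a.support, (a n * qInt q 2 ^ n) • v n
  have hyS : y ∈ Submodule.span ℂ (Set.range v) :=
    Submodule.sum_mem _ fun n _ => Submodule.smul_mem _ _ (Submodule.subset_span ⟨n, rfl⟩)
  have hyM : y ∈ Mono q d := Submodule.sum_mem _ fun n _ => Submodule.smul_mem _ _ (hvM n)
  have hy : ∀ c, coef 0 d c y =
      ∑ n ∈ a.support, if c = c₀ + 2 * n then a n else 0 := by
    intro c
    rw [map_sum]
    refine Finset.sum_congr rfl fun n _ => ?_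
    rw [map_smul, hv, coef_sigmaDelta_e_pow hq hw, smul_eq_mul]
    split_ifs
    · rw [mul_assoc, ← mul_pow, mul_inv_cancel₀ h2, one_pow, mul_one]
    · rw [mul_zero]
  suffices x - y = 0 by rwa [sub_eq_zero.1 this]
  refine Mono_eq_zero hq (Submodule.sub_mem _ hx hyM) fun c => ?_
  rw [map_sub, hy, sub_eq_zero]
  by_cases hc : ∃ n, c = c₀ + 2 * n
  · obtain ⟨n, rfl⟩ := hc
    have : ∀ m, (c₀ + 2 * n = c₀ + 2 * m) = (n = m) := fun m => by
      apply propext; omega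
    simp only [this, Finset.sum_ite_eq]
    split_ifs with hn
    · rfl
    · rw [Finsupp.notMem_support_iff] at hn
      exact hn
  · rw [not_ne_iff.1 (mt (hxc c) hc), Finset.sum_eq_zero]
    intro n _
    rw [if_neg fun h => hc ⟨n, h⟩]

/-! ### Lowest weight vectors of the even and the odd half -/

/-- The even monogenic `x₂ ^ d` of lowest weight. -/
theorem mon_mem_MonoPlus (q : ℂ) (d : ℕ) : mon 0 d 0 ∈ MonoPlus q d := by
  rw [mem_MonoPlus, mem_Mono, mem_PSdeg]
  refine ⟨⟨by simp [opF_mon, qInt_zero], fun a b c hc => ?_⟩, by simp [parity_mon]⟩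
  rw [coef_mon] at hc
  by_contra h
  exact hc (if_neg (by omega))

theorem isLowest_mon (hq : IsGeneric q) (d : ℕ) :
    IsLowest (sigmaDelta q hq) (q ^ (1 - 2 * (d : ℤ))) (mon 0 d 0) where
  f_apply := by simp [sigmaDelta_f_mon, qInt_zero]
  k_apply := by
    rw [sigmaDelta_k_mon, zpow_sub₀ hq.ne_zero]
    congr 1
    rw [inv_pow, div_eq_mul_inv]
    norm_cast

/-- The coefficients of the odd monogenic of lowest weight. -/
def oddCoeff (q : ℂ) (d : ℕ) : ℕ → ℂ
  | 0 => 1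
  | j + 1 => q⁻¹ ^ (2 * j) * q ^ (2 * (d - j)) * qInt (q ^ 2) (d - j) * qInt q (2 * (d - j) + 1) *
      oddCoeff q d j / qInt (q ^ 2) (j + 1)

/-- The odd monogenic of lowest weight. -/
def oddLow (q : ℂ) (d : ℕ) : PS :=
  ∑ j ∈ Finset.range (d + 1), oddCoeff q d j • mon j (d - j) (2 * (d - j) + 1)

theorem coef_oddLow (a b c : ℕ) : coef a b c (oddLow q d) =
    if a + b = d ∧ c = 2 * b + 1 then oddCoeff q d a else 0 := by
  simp only [oddLow, map_sum, map_smul, coef_mon, smul_eq_mul]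
  by_cases h : a + b = d ∧ c = 2 * b + 1
  · rw [if_pos h, Finset.sum_eq_single a, if_pos (by omega), mul_one]
    · intro j _ hj
      rw [if_neg (by omega), mul_zero]
    · intro ha
      exact absurd (Finset.mem_range.2 (by omega)) ha
  · rw [if_neg h]
    refine Finset.sum_eq_zero fun j hj => ?_
    rw [Finset.mem_range] at hj
    rw [if_neg (by omega), mul_zero]

theorem oddLow_mem_MonoMinus (hq : IsGeneric q) (d : ℕ) : oddLow q d ∈ MonoMinus q d := by
  rw [mem_MonoMinus, mem_Mono, mem_PSdeg]
  refine ⟨⟨eq_zero_of_coef fun a b c => ?_, fun a b c hc => ?_⟩, ext_coef fun a b c => ?_⟩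
  · cases c with
    | zero => rw [coef_opF_zero, coef_oddLow, if_neg (by omega), mul_zero, neg_zero]
    | succ c =>
      rw [coef_opF_succ, coef_oddLow, coef_oddLow]
      -- The two contributing monomials lie in the support of `oddLow` simultaneously or not at all;
      -- in the first case the recursion defining `oddCoeff` is the required cancellation.
      by_cases h : a + 1 + b = d ∧ c = 2 * b + 1
      · obtain ⟨rfl, rfl⟩ := h
        rw [if_pos ⟨rfl, rfl⟩, if_pos (by omega), oddCoeff,
          mul_div_cancel₀ _ (qInt_succ_ne_zero hq.sq a)]
        have e : a + 1 + b - a = b + 1 := by omega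
        rw [e, show 2 * (b + 1) + 1 = 2 * b + 1 + 2 by ring]
        ring
      · rw [if_neg h, if_neg (by omega), mul_zero, mul_zero, sub_zero]
  · rw [coef_oddLow] at hc
    by_contra h
    exact hc (if_neg (by omega))
  · rw [coef_parity, map_neg, coef_oddLow]
    by_cases h : a + b = d ∧ c = 2 * b + 1
    · rw [h.2, Odd.neg_one_pow ⟨b, rfl⟩, neg_one_mul]
    · rw [if_neg h, mul_zero, neg_zero]

theorem coef_zero_oddLow (c : ℕ) :
    coef 0 d c (oddLow q d) = if c = 2 * d + 1 then 1 else 0 := by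
  rw [coef_oddLow]
  simp [oddCoeff]

theorem isLowest_oddLow (hq : IsGeneric q) (d : ℕ) :
    IsLowest (sigmaDelta q hq) (q ^ (3 + 2 * (d : ℤ))) (oddLow q d) where
  f_apply := by
    -- The image under `f` is again monogenic, so it suffices to look at `x₁ = 0`. The support of
    -- `oddLow` leaves only the power `y^(2d-1)` there, and this odd power is too low to occur in a
    -- monogenic of degree `d`.
    have hM := sigmaDelta_mem_Mono hq (Uq.f (q ^ 2)) (mem_MonoMinus.1 (oddLow_mem_MonoMinus hq d)).1
    refine Mono_eq_zero hq hM fun c => ?_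
    cases d with
    | zero => simp [oddLow, oddCoeff, sigmaDelta_f_mon, qInt_zero]
    | succ d =>
      by_cases hc : c = 2 * d + 1
      · rw [hc]
        exact coef_Mono_odd hq (mem_Mono.1 hM).1 d 0 (d + 1) (by omega)
      · rw [coef_zero_sigmaDelta_f, coef_oddLow, coef_oddLow, if_neg (by omega),
          if_neg (by omega), mul_zero, mul_zero, sub_zero]
  k_apply := by
    rw [oddLow, map_sum, Finset.smul_sum]
    refine Finset.sum_congr rfl fun j hj => ?_
    obtain ⟨b, rfl⟩ := Nat.exists_eq_add_of_le (Nat.lt_succ_iff.1 (Finset.mem_range.1 hj))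
    rw [map_smul, sigmaDelta_k_mon, smul_smul, smul_smul, mul_comm]
    congr 2
    have hq0 := hq.ne_zero
    rw [show (3 + 2 * ((j + b : ℕ) : ℤ)) = ((3 + 2 * (j + b) : ℕ) : ℤ) by push_cast; ring,
      zpow_natCast, Nat.add_sub_cancel_left, inv_pow]
    field_simp
    ring_nf

theorem MonoPlus_eq_span (hq : IsGeneric q) (d : ℕ) : MonoPlus q d =
    Submodule.span ℂ (Set.range fun n : ℕ =>
      (sigmaDelta q hq (Uq.e (q ^ 2)) ^ n) (mon 0 d 0)) := by
  have hw := mon_mem_MonoPlus q d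
  refine le_antisymm (fun x hx => ?_) (Submodule.span_le.2 ?_)
  · refine mem_span_of_coef hq (c₀ := 0) (mem_MonoPlus.1 hw).1
      (fun c => by simp [coef_mon, eq_comm]) (mem_MonoPlus.1 hx).1 fun c hc => ?_
    rw [MonoPlus, Submodule.mem_inf, mem_degTensor SPlus_eq] at hx
    obtain ⟨n, hn⟩ := (hx.2 _ _ _ hc).2
    exact ⟨n, by omega⟩
  · rintro _ ⟨n, rfl⟩
    rw [SetLike.mem_coe, mem_MonoPlus] at *
    simp only [← map_pow]
    exact ⟨sigmaDelta_mem_Mono hq _ hw.1, by rw [parity_sigmaDelta, hw.2]⟩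

/-- At `x₁ = 0` an odd monogenic has only the odd powers of `y` from `y^(2d+1)` on, and these are
reached by the `e^n` applied to `oddLow`. This jump is why the lowest weight grows with `d`. -/
theorem MonoMinus_eq_span (hq : IsGeneric q) (d : ℕ) : MonoMinus q d =
    Submodule.span ℂ (Set.range fun n : ℕ =>
      (sigmaDelta q hq (Uq.e (q ^ 2)) ^ n) (oddLow q d)) := by
  have hw := oddLow_mem_MonoMinus hq d
  refine le_antisymm (fun x hx => ?_) (Submodule.span_le.2 ?_)
  · refine mem_span_of_coef hq (c₀ := 2 * d + 1) (mem_MonoMinus.1 hw).1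
      coef_zero_oddLow (mem_MonoMinus.1 hx).1 fun c hc => ?_
    have hF := (mem_Mono.1 (mem_MonoMinus.1 hx).1).1
    rw [MonoMinus, Submodule.mem_inf, mem_degTensor SMinus_eq] at hx
    obtain ⟨n, rfl⟩ := (hx.2 _ _ _ hc).2
    by_cases hn : n < d
    · exact absurd (coef_Mono_odd hq hF n 0 d hn) hc
    · exact ⟨n - d, by omega⟩
  · rintro _ ⟨n, rfl⟩
    rw [SetLike.mem_coe, mem_MonoMinus] at *
    simp only [← map_pow]
    exact ⟨sigmaDelta_mem_Mono hq _ hw.1, by rw [parity_sigmaDelta, hw.2, map_neg]⟩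

theorem mon_ne_zero (a b c : ℕ) : mon a b c ≠ 0 := by
  rw [← monBasis_apply (a, b, c)]
  exact monBasis.ne_zero _

theorem oddLow_ne_zero (q : ℂ) (d : ℕ) : oddLow q d ≠ 0 := fun h => by
  have := coef_zero_oddLow (q := q) (d := d) (2 * d + 1)
  rw [h, map_zero, if_pos rfl] at this
  exact zero_ne_one this

/-! ### Genericity of the weights and identification of the two halves -/

theorem IsGeneric.zpow_ne_one (hq : IsGeneric q) {n : ℤ} (hn : n ≠ 0) : q ^ n ≠ 1 := by
  intro h
  rcases lt_or_gt_of_ne hn with h0 | h0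
  · refine hq.pow_ne_one n.natAbs (by omega) ?_
    rw [← zpow_natCast, Int.ofNat_natAbs_of_nonpos h0.le, zpow_neg, h, inv_one]
  · refine hq.pow_ne_one n.natAbs (by omega) ?_
    rw [← zpow_natCast, Int.natAbs_of_nonneg h0.le, h]

/-- The exponent to be excluded is `2n + 4m`, which is congruent to `2` modulo `4` and so never
zero, even for negative `n`. -/
theorem genericWt_odd (hq : IsGeneric q) {n : ℤ} (hn : Odd n) : GenericWt (q ^ 2) (q ^ n) where
  ne_zero := zpow_ne_zero _ hq.ne_zero
  sq_ne m := by
    have : (q ^ n) ^ 2 * (q ^ 2) ^ (2 * m) = q ^ (2 * n + 4 * m) := by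
      rw [zpow_add₀ hq.ne_zero, mul_comm 2 n, zpow_mul, ← pow_mul]
      norm_cast
      ring_nf
    rw [this]
    obtain ⟨r, rfl⟩ := hn
    exact hq.zpow_ne_one (by omega)

theorem genericWt_pos (hq : IsGeneric q) (n : ℕ) : GenericWt q (q ^ (n + 1)) where
  ne_zero := pow_ne_zero _ hq.ne_zero
  sq_ne m := by
    rw [← pow_mul, ← pow_add]
    exact hq.pow_ne_one _ (by omega)

theorem genericWt_lowWt (hq : IsGeneric q) (i : ℕ × Bool) : GenericWt (q ^ 2) (lowWt q i) := by
  obtain ⟨d, b⟩ := i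
  cases b
  · exact genericWt_odd hq ⟨1 + d, by ring⟩
  · exact genericWt_odd hq ⟨-d, by ring⟩

theorem exists_equiv_of_span {p lam : ℂ} {V : Type*} [AddCommGroup V] [Module ℂ V]
    {ρ : Uq p →ₐ[ℂ] Module.End ℂ V} {v : V} (h : IsLowest ρ lam v) (hp : IsGeneric p)
    (hl : GenericWt p lam) (hv : v ≠ 0) {N : Submodule ℂ V}
    (hN : N = Submodule.span ℂ (Set.range fun n : ℕ => (ρ (Uq.e p) ^ n) v)) :
    ∃ φ : L p lam ≃ₗ[ℂ] N, ∀ (u : Uq p) x, (φ (u • x) : V) = ρ u (φ x) := by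
  obtain ⟨φ, hinj, hφ, -, hr⟩ := h.exists_embedding hp hl hv
  exact ⟨(LinearEquiv.ofInjective φ hinj).trans (LinearEquiv.ofEq _ _ (hr.trans hN.symm)), hφ⟩

/-- A concrete nonzero lowest weight vector in any representation witnesses that the abstractly
presented module does not collapse. -/
theorem L.low_ne_zero_of_isLowest {p lam : ℂ} {V : Type*} [AddCommGroup V] [Module ℂ V]
    {ρ : Uq p →ₐ[ℂ] Module.End ℂ V} {v : V} (h : IsLowest ρ lam v) (hp : IsGeneric p)
    (hl : GenericWt p lam) (hv : v ≠ 0) : L.low p lam ≠ 0 := by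
  obtain ⟨φ, -, -, hφ, -⟩ := h.exists_embedding hp hl hv
  rintro h0
  exact hv (by rw [← hφ, h0, map_zero])

theorem exists_equiv_MonoPlus (hq : IsGeneric q) (d : ℕ) :
    ∃ φ : L (q ^ 2) (q ^ (1 - 2 * (d : ℤ))) ≃ₗ[ℂ] MonoPlus q d,
      ∀ (u : Uq (q ^ 2)) x, (φ (u • x) : PS) = sigmaDelta q hq u (φ x) :=
  exists_equiv_of_span (isLowest_mon hq d) hq.sq (genericWt_lowWt hq (d, true)) (mon_ne_zero _ _ _)
    (MonoPlus_eq_span hq d)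

theorem exists_equiv_MonoMinus (hq : IsGeneric q) (d : ℕ) :
    ∃ φ : L (q ^ 2) (q ^ (3 + 2 * (d : ℤ))) ≃ₗ[ℂ] MonoMinus q d,
      ∀ (u : Uq (q ^ 2)) x, (φ (u • x) : PS) = sigmaDelta q hq u (φ x) :=
  exists_equiv_of_span (isLowest_oddLow hq d) hq.sq (genericWt_lowWt hq (d, false))
    (oddLow_ne_zero q d) (MonoMinus_eq_span hq d)

theorem L.low_ne_zero (hq : IsGeneric q) (i : ℕ × Bool) : L.low (q ^ 2) (lowWt q i) ≠ 0 := by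
  obtain ⟨d, b⟩ := i
  cases b
  · exact L.low_ne_zero_of_isLowest (isLowest_oddLow hq d) hq.sq (genericWt_lowWt hq (d, false))
      (oddLow_ne_zero q d)
  · exact L.low_ne_zero_of_isLowest (isLowest_mon hq d) hq.sq (genericWt_lowWt hq (d, true))
      (mon_ne_zero _ _ _)

end monogenics

/-! ### The triangle -/

section triangle
variable {q : ℂ} {d : ℕ} {x : PS}

theorem sigma_e (hq : IsGeneric q) : sigma q hq (Uq.e q) = opE q := sigma_gen q hq .e

theorem isLowest_Mono (hq : IsGeneric q) (hx : x ∈ Mono q d) :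
    IsLowest (sigma q hq) (q ^ (2 * d + 2)) x where
  f_apply := by rw [sigma_gen]; exact (mem_Mono.1 hx).1
  k_apply := by rw [sigma_gen]; exact (mem_PSdeg_iff_opK hq).1 (mem_Mono.1 hx).2

theorem opF_opE_pow (hq : IsGeneric q) (hx : x ∈ Mono q d) (k : ℕ) :
    opF q ((opE q ^ (k + 1)) x) =
      -lowerCoeff q (q ^ (2 * d + 2)) (k + 1) • (opE q ^ k) x := by
  have h := (isLowest_Mono hq hx).f_pow_succ hq (pow_ne_zero _ hq.ne_zero) k
  rwa [sigma_gen, sigma_e] at h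

theorem opE_mem_PSdeg (hq : IsGeneric q) (hx : x ∈ PSdeg d) : opE q x ∈ PSdeg (d + 1) := by
  rw [mem_PSdeg_iff_opK hq] at hx ⊢
  have h := LinearMap.congr_fun (opK_opE (q := q)) x
  rw [LinearMap.smul_apply, Module.End.mul_apply, Module.End.mul_apply, hx, map_smul,
    smul_smul] at h
  rw [h]
  congr 1
  ring

theorem opF_mem_PSdeg (hq : IsGeneric q) (hx : x ∈ PSdeg (d + 1)) : opF q x ∈ PSdeg d := by
  rw [mem_PSdeg_iff_opK hq] at hx ⊢
  have hq0 := hq.ne_zero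
  have h := LinearMap.congr_fun (opK_opF hq0) x
  rw [LinearMap.smul_apply, Module.End.mul_apply, Module.End.mul_apply, hx, map_smul,
    smul_smul] at h
  rw [h]
  congr 1
  field_simp
  ring

theorem opF_eq_zero_of_mem_PSdeg (hq : IsGeneric q) (hx : x ∈ PSdeg 0) : opF q x = 0 := by
  have hx' := hx
  rw [mem_PSdeg] at hx'
  have hq0 := hq.ne_zero
  refine eq_zero_of_coef fun a b c => ?_
  have h1 : ∀ a b c, a + b ≠ 0 → coef a b c x = 0 := fun a b c h => by
    by_contra hc
    exact h (hx' a b c hc)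
  cases c with
  | zero => rw [coef_opF_zero, h1 _ _ _ (by omega), mul_zero, neg_zero]
  | succ c =>
    rw [coef_opF_succ, h1 _ _ _ (by omega), h1 _ _ _ (by omega), mul_zero, mul_zero, sub_zero]

theorem opE_pow_mem_PSdeg (hq : IsGeneric q) (hx : x ∈ PSdeg d) (k : ℕ) :
    (opE q ^ k) x ∈ PSdeg (d + k) := by
  induction k with
  | zero => simpa using hx
  | succ k ih =>
    rw [pow_succ', Module.End.mul_apply]
    exact opE_mem_PSdeg hq ih

theorem rowEntry_le_PSdeg (hq : IsGeneric q) (d k : ℕ) : rowEntry q d k ≤ PSdeg (d + k) := by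
  rintro _ ⟨x, hx, rfl⟩
  exact opE_pow_mem_PSdeg hq (mem_Mono.1 hx).2 k

theorem map_opE_rowEntry (q : ℂ) (d k : ℕ) :
    (rowEntry q d k).map (opE q) = rowEntry q d (k + 1) := by
  rw [rowEntry, rowEntry, pow_succ', Module.End.mul_eq_comp, Submodule.map_comp]

/-- The scalar depends only on `d` and `k`, and it is nonzero; so `F E` is invertible on every entry
of the triangle. This gives both the injectivity of the arrows and the induction over columns. -/
theorem opF_opE_of_mem_rowEntry (hq : IsGeneric q) {k : ℕ} (hx : x ∈ rowEntry q d k) :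
    opF q (opE q x) = -lowerCoeff q (q ^ (2 * d + 2)) (k + 1) • x := by
  obtain ⟨m, hm, rfl⟩ := hx
  rw [← Module.End.mul_apply (opE q), ← pow_succ', opF_opE_pow hq hm]

theorem bijOn_opE (hq : IsGeneric q) (d k : ℕ) :
    Set.BijOn (opE q) (rowEntry q d k) (rowEntry q d (k + 1)) := by
  rw [← map_opE_rowEntry]
  refine ⟨fun x hx => ⟨x, hx, rfl⟩, fun x hx y hy h => ?_, fun x hx => hx⟩
  have h2 := congrArg (opF q) h
  rw [opF_opE_of_mem_rowEntry hq hx, opF_opE_of_mem_rowEntry hq hy] at h2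
  exact smul_right_injective _
    (neg_ne_zero.2 (lowerCoeff_ne_zero hq (genericWt_pos hq (2 * d + 1)) k)) h2

theorem opE_pow_injOn (hq : IsGeneric q) (hx : x ∈ Mono q d) (k : ℕ)
    (h : (opE q ^ k) x = 0) : x = 0 := by
  by_contra hx0
  have := (isLowest_Mono hq hx).pow_ne_zero hq (genericWt_pos hq (2 * d + 1)) hx0 k
  rw [sigma_e] at this
  exact this h

/-! ### Separation of rows and exhaustion of columns -/

/-- The Casimir operator of `U_q(sl₂)`, multiplied by `(q - q⁻¹)²`. -/
def opCasimir (q : ℂ) : Module.End ℂ PS :=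
  (q - q⁻¹) ^ 2 • (opF q * opE q) + q • opK q + q⁻¹ • opKInv q

theorem opCasimir_of_mem_rowEntry (hq : IsGeneric q) {k : ℕ} (hx : x ∈ rowEntry q d k) :
    opCasimir q x = (q ^ (2 * d + 1) + (q ^ (2 * d + 1))⁻¹) • x := by
  have hq0 := hq.ne_zero
  have hs := hq.sub_inv_ne_zero
  have hs2 : q ^ 2 - 1 ≠ 0 := sub_ne_zero.2 (hq.pow_ne_one 2 (by norm_num))
  have hK : opK q x = q ^ (2 * (d + k) + 2) • x :=
    (mem_PSdeg_iff_opK hq).1 (rowEntry_le_PSdeg hq d k hx)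
  have hK' : opKInv q x = (q ^ (2 * (d + k) + 2))⁻¹ • x := by
    rw [eq_inv_smul_iff₀ (pow_ne_zero _ hq0), ← map_smul, ← hK, ← Module.End.mul_apply,
      opKInv_mul_opK hq0, Module.End.one_apply]
  simp only [opCasimir, LinearMap.add_apply, LinearMap.smul_apply, Module.End.mul_apply, hK, hK',
    opF_opE_of_mem_rowEntry hq hx, smul_smul, ← add_smul]
  congr 1
  have e1 : q ^ (2 * d + 2) = (q ^ d) ^ 2 * q ^ 2 := by ring
  have e2 : q ^ (2 * d + 1) = (q ^ d) ^ 2 * q := by ring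
  have e3 : q ^ (2 * (d + k) + 2) = (q ^ d) ^ 2 * (q ^ k) ^ 2 * q ^ 2 := by ring
  have e4 : q ^ (k + 1) = q ^ k * q := by ring
  have hd : q ^ d ≠ 0 := pow_ne_zero _ hq0
  have hk : q ^ k ≠ 0 := pow_ne_zero _ hq0
  simp only [lowerCoeff, e1, e2, e3, e4]
  generalize q ^ d = u at *
  generalize q ^ k = v at *
  field_simp
  ring

/-- `s + s⁻¹ = t + t⁻¹` forces `s = t` or `s t = 1`; here `s t` is a positive power of `q`. -/
theorem casimir_eigenvalue_injective (hq : IsGeneric q) :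
    Function.Injective fun d : ℕ => q ^ (2 * d + 1) + (q ^ (2 * d + 1))⁻¹ := by
  intro m n h
  have hm : q ^ (2 * m + 1) ≠ 0 := pow_ne_zero _ hq.ne_zero
  have hn : q ^ (2 * n + 1) ≠ 0 := pow_ne_zero _ hq.ne_zero
  have h1 : q ^ (2 * m + 1) * q ^ (2 * n + 1) ≠ 1 := by
    rw [← pow_add]
    exact hq.pow_ne_one _ (by omega)
  have h2 : (q ^ (2 * m + 1) - q ^ (2 * n + 1)) *
      (q ^ (2 * m + 1) * q ^ (2 * n + 1) - 1) = 0 := by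
    simp only at h
    field_simp at h
    linear_combination h
  have h3 := sub_eq_zero.1 ((mul_eq_zero.1 h2).resolve_right (sub_ne_zero.2 h1))
  have := hq.pow_injective h3
  omega

theorem iSupIndep_casimir (hq : IsGeneric q) : iSupIndep fun d : ℕ =>
    (opCasimir q).eigenspace (q ^ (2 * d + 1) + (q ^ (2 * d + 1))⁻¹) :=
  (opCasimir q).eigenspaces_iSupIndep.comp (casimir_eigenvalue_injective hq)

theorem rowEntry_le_eigenspace (hq : IsGeneric q) (d k : ℕ) : rowEntry q d k ≤
    (opCasimir q).eigenspace (q ^ (2 * d + 1) + (q ^ (2 * d + 1))⁻¹) := fun _ hx =>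
  Module.End.mem_eigenspace_iff.2 (opCasimir_of_mem_rowEntry hq hx)

theorem iSupIndep_rows (hq : IsGeneric q) : iSupIndep fun d : ℕ => ⨆ k : ℕ, rowEntry q d k :=
  (iSupIndep_casimir hq).mono fun d => iSup_le (rowEntry_le_eigenspace hq d)

/-- The entries of a column lie in pairwise distinct rows, so the Casimir operator separates them.
-/
theorem iSupIndep_column (hq : IsGeneric q) (d : ℕ) :
    iSupIndep fun k : Fin (d + 1) => rowEntry q (d - k) k := by
  have hinj : Function.Injective fun k : Fin (d + 1) => d - (k : ℕ) := fun i j h => by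
    simp only at h
    ext
    omega
  exact ((iSupIndep_casimir hq).comp hinj).mono fun k => rowEntry_le_eigenspace hq _ _

/-- In the inductive step, `F E` is a nonzero scalar on each entry of column `d` and hence maps that
column onto itself. So `F x = F E w` for some `w` in it. Then `x - E w` is monogenic, and `E w` lies
in the image of column `d`, which consists of the remaining entries of column `d + 1`. -/
theorem iSup_column (hq : IsGeneric q) (d : ℕ) :
    ⨆ k : Fin (d + 1), rowEntry q (d - k) k = PSdeg d := by
  refine le_antisymm (iSup_le fun k => ?_) ?_
  · have h := rowEntry_le_PSdeg hq (d - k) k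
    rwa [Nat.sub_add_cancel (Nat.lt_succ_iff.1 k.2)] at h
  · induction d with
    | zero =>
      intro x hx
      exact Submodule.mem_iSup_of_mem 0
        ⟨x, mem_Mono.2 ⟨opF_eq_zero_of_mem_PSdeg hq hx, hx⟩, rfl⟩
    | succ d ih =>
      intro x hx
      have key : PSdeg d ≤
          (⨆ k : Fin (d + 1), rowEntry q (d - k) k).map (opF q * opE q) := by
        refine ih.trans (iSup_le fun k y hy => ?_)
        set c := -lowerCoeff q (q ^ (2 * (d - k) + 2)) (k + 1) with hc
        have hc0 : c ≠ 0 := neg_ne_zero.2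
          (lowerCoeff_ne_zero hq (genericWt_pos hq (2 * (d - k) + 1)) k)
        refine ⟨c⁻¹ • y, Submodule.smul_mem _ _ (Submodule.mem_iSup_of_mem k hy), ?_⟩
        rw [map_smul, Module.End.mul_apply, opF_opE_of_mem_rowEntry hq hy, ← hc, smul_smul,
          inv_mul_cancel₀ hc0, one_smul]
      obtain ⟨w, hw, hw'⟩ := key (opF_mem_PSdeg hq hx)
      rw [Module.End.mul_apply] at hw'
      have hle : (⨆ k : Fin (d + 1), rowEntry q (d - k) k) ≤ PSdeg d := iSup_le fun k => by
        have h := rowEntry_le_PSdeg hq (d - k) k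
        rwa [Nat.sub_add_cancel (Nat.lt_succ_iff.1 k.2)] at h
      rw [← sub_add_cancel x (opE q w)]
      refine Submodule.add_mem _ ?_ ?_
      · refine Submodule.mem_iSup_of_mem 0 ⟨x - opE q w, mem_Mono.2 ⟨?_, ?_⟩, rfl⟩
        · rw [map_sub, hw', sub_self]
        · exact Submodule.sub_mem _ hx (opE_mem_PSdeg hq (hle hw))
      · have h1 : opE q w ∈ (⨆ k : Fin (d + 1), rowEntry q (d - k) k).map (opE q) := ⟨w, hw, rfl⟩
        rw [Submodule.map_iSup] at h1
        refine (iSup_le fun k => ?_ : _ ≤ ⨆ k : Fin (d + 1 + 1), rowEntry q (d + 1 - k) k) h1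
        rw [map_opE_rowEntry]
        -- Applying `E` moves entry `k` to entry `k + 1` of the next column without changing its
        -- row: `d + 1 - (k + 1) = d - k`.
        have h2 := le_iSup (fun k : Fin (d + 1 + 1) => rowEntry q (d + 1 - k) k) k.succ
        simpa using h2

theorem iSup_PSdeg : ⨆ d, PSdeg d = ⊤ := by
  rw [eq_top_iff, ← monBasis.span_eq, Submodule.span_le]
  rintro _ ⟨i, rfl⟩
  refine Submodule.mem_iSup_of_mem (i.1 + i.2.1) (mem_PSdeg.2 fun a b c hc => ?_)
  rw [monBasis_apply, coef_mon] at hc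
  by_contra h
  exact hc (if_neg (by omega))

theorem isInternal_PSdeg (hq : IsGeneric q) : DirectSum.IsInternal PSdeg := by
  rw [DirectSum.isInternal_submodule_iff_iSupIndep_and_iSup_eq_top]
  refine ⟨?_, iSup_PSdeg⟩
  have hinj : Function.Injective fun d : ℕ => q ^ (2 * d + 2) := fun m n h => by
    have := hq.pow_injective h
    omega
  exact ((opK q).eigenspaces_iSupIndep.comp hinj).mono fun d x hx =>
    Module.End.mem_eigenspace_iff.2 ((mem_PSdeg_iff_opK hq).1 hx)

theorem iSup_rows (hq : IsGeneric q) : ⨆ d : ℕ, ⨆ k : ℕ, rowEntry q d k = ⊤ := by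
  rw [eq_top_iff, ← iSup_PSdeg]
  refine iSup_le fun d => ?_
  rw [← iSup_column hq]
  exact iSup_le fun k => le_iSup_of_le (d - k) (le_iSup (rowEntry q (d - k)) k)

end triangle

/-! ### The joint decomposition -/

theorem L.low_ne_zero_sigma {q : ℂ} (hq : IsGeneric q) (d : ℕ) :
    L.low q (q ^ (2 * d + 2)) ≠ 0 :=
  L.low_ne_zero_of_isLowest (isLowest_Mono hq (mem_MonoPlus.1 (mon_mem_MonoPlus q d)).1) hq
    (genericWt_pos hq (2 * d + 1)) (mon_ne_zero _ _ _)

/-- Two representations agree along a map that intertwines the basis `e ^ n v` of `L q lam` with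
the vectors `e ^ n w` for a lowest weight vector `w` of the same weight. -/
theorem apply_smul_eq {q lam : ℂ} (hq : IsGeneric q) (hl : GenericWt q lam)
    (h0 : L.low q lam ≠ 0) {V : Type*} [AddCommGroup V] [Module ℂ V]
    {ρ : Uq q →ₐ[ℂ] Module.End ℂ V} {w : V} (h : IsLowest ρ lam w) {T : L q lam →ₗ[ℂ] V}
    (hT : ∀ n, T (L.basis hq hl h0 n) = (ρ (Uq.e q) ^ n) w) (u : Uq q) (y : L q lam) :
    T (u • y) = ρ u (T y) := by
  have hT' : ∀ n, T ((Algebra.lsmul ℂ ℂ (L q lam) (Uq.e q) ^ n) (L.low q lam)) =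
      (ρ (Uq.e q) ^ n) w := fun n => by rw [← hT, L.basis_apply]
  induction u using Uq.induction generalizing y with
  | scalar c => rw [algebraMap_smul, map_smul, AlgHom.commutes, Module.algebraMap_end_apply]
  | mul a b ha hb => rw [mul_smul, ha, hb, map_mul, Module.End.mul_apply]
  | add a b ha hb => rw [add_smul, map_add, ha, hb, map_add, LinearMap.add_apply]
  | gen g =>
    suffices T ∘ₗ Algebra.lsmul ℂ ℂ (L q lam) (Uq.gen q g) = ρ (Uq.gen q g) ∘ₗ T from
      LinearMap.congr_fun this y
    refine (L.basis hq hl h0).ext fun n => ?_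
    rw [LinearMap.comp_apply, LinearMap.comp_apply, hT, L.basis_apply]
    have hlow := L.isLowest_low q lam
    cases g with
    | e => rw [← Module.End.mul_apply, ← Module.End.mul_apply, ← pow_succ', ← pow_succ', hT']
    | k => rw [hlow.k_pow, h.k_pow, map_smul, hT']
    | kinv =>
      rw [hlow.kinv_pow hq.ne_zero hl.ne_zero, h.kinv_pow hq.ne_zero hl.ne_zero, map_smul, hT']
    | f =>
      cases n with
      | zero => simp only [pow_zero, Module.End.one_apply, hlow.f_apply, h.f_apply, map_zero]
      | succ n =>
        rw [hlow.f_pow_succ hq hl.ne_zero, h.f_pow_succ hq hl.ne_zero, map_smul, hT']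

/-- Parametrize the monogenics of degree `d` by a vector space `X`. Then `X ⊗ L_q(2d + 2)`
parametrizes the sum of the `E ^ k (M ^ d)`. -/
theorem exists_tensor_embedding {q : ℂ} (hq : IsGeneric q) (d : ℕ) {X : Type*} [AddCommGroup X]
    [Module ℂ X] (ψ : X →ₗ[ℂ] PS) (hψ : Function.Injective ψ)
    (hr : LinearMap.range ψ = Mono q d) :
    ∃ T : X ⊗[ℂ] L q (q ^ (2 * d + 2)) →ₗ[ℂ] PS, Function.Injective T ∧
      LinearMap.range T = ⨆ k : ℕ, rowEntry q d k ∧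
      ∀ (A : Module.End ℂ X) (u : Uq (q ^ 2)), (∀ p, ψ (A p) = sigmaDelta q hq u (ψ p)) →
        ∀ (v : Uq q) p y, T (A p ⊗ₜ (v • y)) = sigmaDelta q hq u (sigma q hq v (T (p ⊗ₜ y))) := by
  have hl := genericWt_pos hq (2 * d + 1)
  let b := L.basis hq hl (L.low_ne_zero_sigma hq d)
  have hmem : ∀ p, ψ p ∈ Mono q d := fun p => hr ▸ LinearMap.mem_range_self ψ p
  -- The map is prescribed on the basis `e^k v` of the second factor, with `e^k` replaced by `E^k`.
  let T : X ⊗[ℂ] L q (q ^ (2 * d + 2)) →ₗ[ℂ] PS :=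
    TensorProduct.lift (b.constr ℂ fun k => (opE q ^ k) ∘ₗ ψ).flip
  have hT : ∀ p k, T (p ⊗ₜ b k) = (opE q ^ k) (ψ p) := fun p k => by
    rw [TensorProduct.lift.tmul, LinearMap.flip_apply, Module.Basis.constr_basis,
      LinearMap.comp_apply]
  refine ⟨T, ?_, ?_, ?_⟩
  · rw [← LinearMap.ker_eq_bot, LinearMap.ker_eq_bot']
    intro x hx
    obtain ⟨m, rfl⟩ := (TensorProduct.equivFinsuppOfBasisRight b).symm.surjective x
    suffices m = 0 by rw [this, map_zero]
    rw [TensorProduct.equivFinsuppOfBasisRight_symm_apply, Finsupp.sum, map_sum] at hx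
    simp only [hT] at hx
    ext k
    by_contra hk
    have hdeg : ∀ j, (opE q ^ j) (ψ (m j)) ∈ PSdeg (d + j) := fun j =>
      opE_pow_mem_PSdeg hq (mem_Mono.1 (hmem _)).2 j
    -- The summands `E^j ψ(m j)` have the distinct degrees `d + j`, so each of them vanishes
    -- separately.
    have hk0 : (opE q ^ k) (ψ (m k)) = 0 :=
      (iSupIndep_iff_finsetSum_eq_zero_imp_eq_zero _).1
        ((isInternal_PSdeg hq).submodule_iSupIndep.comp (add_right_injective d)) m.support
        (fun j => (opE q ^ j) (ψ (m j))) (fun j _ => hdeg j) hx k (Finsupp.mem_support_iff.2 hk)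
    refine hk (hψ ?_)
    rw [opE_pow_injOn hq (hmem _) k hk0, Finsupp.zero_apply, map_zero]
  · refine le_antisymm ?_ (iSup_le fun k => ?_)
    · rintro _ ⟨x, rfl⟩
      obtain ⟨m, rfl⟩ := (TensorProduct.equivFinsuppOfBasisRight b).symm.surjective x
      rw [TensorProduct.equivFinsuppOfBasisRight_symm_apply, Finsupp.sum, map_sum]
      refine Submodule.sum_mem _ fun k _ => Submodule.mem_iSup_of_mem k ?_
      rw [hT]
      exact ⟨_, hmem _, rfl⟩
    · rintro _ ⟨x, hx, rfl⟩
      rw [SetLike.mem_coe, ← hr] at hx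
      obtain ⟨p, rfl⟩ := hx
      exact ⟨p ⊗ₜ b k, hT p k⟩
  · intro A u hA v p y
    -- Equivariance in the first factor holds because `E^k` commutes with `σ_Δ`; in the second
    -- factor it will follow because `ψ p` is a lowest weight vector for `σ`.
    have h1 : ∀ y, T (A p ⊗ₜ y) = sigmaDelta q hq u (T (p ⊗ₜ y)) := fun y => by
      suffices T ∘ₗ TensorProduct.mk ℂ X _ (A p) =
          sigmaDelta q hq u ∘ₗ T ∘ₗ TensorProduct.mk ℂ X _ p from LinearMap.congr_fun this y
      refine b.ext fun k => ?_
      simp only [LinearMap.comp_apply, TensorProduct.mk_apply, hT, hA]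
      exact LinearMap.congr_fun ((commute_sigmaDelta_opE q hq u).pow_right k).eq.symm (ψ p)
    rw [h1]
    congr 1
    refine apply_smul_eq hq hl (L.low_ne_zero_sigma hq d) (isLowest_Mono hq (hmem p))
      (T := T ∘ₗ TensorProduct.mk ℂ X _ p) (fun n => ?_) v y
    rw [LinearMap.comp_apply, TensorProduct.mk_apply, sigma_e]
    exact hT p n

/-- A sum of embeddings with independent ranges is a decomposition. -/
theorem toModule_bijective {ι V : Type*} [DecidableEq ι] [AddCommGroup V] [Module ℂ V]
    {Z : ι → Type*} [∀ i, AddCommGroup (Z i)] [∀ i, Module ℂ (Z i)] (T : ∀ i, Z i →ₗ[ℂ] V)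
    (hT : ∀ i, Function.Injective (T i)) (hind : iSupIndep fun i => LinearMap.range (T i))
    (htop : ⨆ i, LinearMap.range (T i) = ⊤) :
    Function.Bijective (DirectSum.toModule ℂ ι V T) := by
  classical
  constructor
  · rw [← LinearMap.ker_eq_bot, LinearMap.ker_eq_bot']
    intro x hx
    rw [← DirectSum.sum_support_of x, map_sum] at hx
    have h0 := (iSupIndep_iff_finsetSum_eq_zero_imp_eq_zero _).1 hind (DFinsupp.support x)
      (fun i => T i (x i)) (fun i _ => LinearMap.mem_range_self _ _)
      (by simpa only [← DirectSum.lof_eq_of ℂ, DirectSum.toModule_lof] using hx)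
    refine DFinsupp.ext fun i => ?_
    by_contra hi
    exact hi (hT i ((h0 i (DFinsupp.mem_support_iff.2 hi)).trans (map_zero _).symm))
  · rw [← LinearMap.range_eq_top, eq_top_iff, ← htop]
    refine iSup_le fun i => ?_
    rintro _ ⟨z, rfl⟩
    exact ⟨DirectSum.lof ℂ ι Z i z, DirectSum.toModule_lof ℂ i z⟩

/-- The monogenics of degree `d` as a sum of two lowest weight modules. -/
theorem exists_Mono_param {q : ℂ} (hq : IsGeneric q) (d : ℕ) :
    ∃ ψ : L (q ^ 2) (q ^ (1 - 2 * (d : ℤ))) × L (q ^ 2) (q ^ (3 + 2 * (d : ℤ))) →ₗ[ℂ] PS,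
      Function.Injective ψ ∧ LinearMap.range ψ = Mono q d ∧
      ∀ (u : Uq (q ^ 2)) p, ψ (u • p) = sigmaDelta q hq u (ψ p) := by
  obtain ⟨φ, hφ⟩ := exists_equiv_MonoPlus hq d
  obtain ⟨φ', hφ'⟩ := exists_equiv_MonoMinus hq d
  let α := (MonoPlus q d).subtype ∘ₗ φ.toLinearMap
  let α' := (MonoMinus q d).subtype ∘ₗ φ'.toLinearMap
  have hα : LinearMap.range α = MonoPlus q d := by
    rw [LinearMap.range_comp_of_range_eq_top _ φ.range, Submodule.range_subtype]
  have hα' : LinearMap.range α' = MonoMinus q d := by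
    rw [LinearMap.range_comp_of_range_eq_top _ φ'.range, Submodule.range_subtype]
  refine ⟨α.coprod α', ?_, ?_, fun u p => ?_⟩
  · rw [← LinearMap.ker_eq_bot, LinearMap.ker_coprod_of_disjoint_range,
      LinearMap.ker_eq_bot.2 (Subtype.val_injective.comp φ.injective),
      LinearMap.ker_eq_bot.2 (Subtype.val_injective.comp φ'.injective), Submodule.prod_bot]
    rw [hα, hα']
    exact disjoint_MonoPlus_MonoMinus q d
  · rw [LinearMap.range_coprod, hα, hα', MonoPlus_sup_MonoMinus]
  · rw [LinearMap.coprod_apply, LinearMap.coprod_apply, map_add]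
    exact congrArg₂ (· + ·) (hφ u p.1) (hφ' u p.2)

theorem exists_decomposition {q : ℂ} (hq : IsGeneric q) :
    ∃ Φ : (⨁ d : ℕ, (L (q ^ 2) (q ^ (1 - 2 * (d : ℤ))) × L (q ^ 2) (q ^ (3 + 2 * (d : ℤ))))
          ⊗[ℂ] L q (q ^ (2 * d + 2))) ≃ₗ[ℂ] PS,
      (∀ (u : Uq (q ^ 2)) (v : Uq q) x,
        Φ (DirectSum.lmap (fun d : ℕ => outerAct (Uq (q ^ 2)) (Uq q)
            (L (q ^ 2) (q ^ (1 - 2 * (d : ℤ))) × L (q ^ 2) (q ^ (3 + 2 * (d : ℤ))))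
            (L q (q ^ (2 * d + 2))) (u ⊗ₜ v)) x) =
          sigmaDelta q hq u (sigma q hq v (Φ x))) ∧
      ∀ d : ℕ, (LinearMap.range (DirectSum.lof ℂ ℕ (fun d : ℕ =>
            (L (q ^ 2) (q ^ (1 - 2 * (d : ℤ))) × L (q ^ 2) (q ^ (3 + 2 * (d : ℤ))))
              ⊗[ℂ] L q (q ^ (2 * d + 2))) d)).map Φ.toLinearMap =
          ⨆ k : ℕ, rowEntry q d k := by
  choose ψ hψ hr hu using exists_Mono_param hq
  choose T hT hrT hA using fun d => exists_tensor_embedding hq d (ψ d) (hψ d) (hr d)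
  have hbij := toModule_bijective T hT (by simpa only [hrT] using iSupIndep_rows hq)
    (by simpa only [hrT] using iSup_rows hq)
  refine ⟨LinearEquiv.ofBijective _ hbij, fun u v x => ?_, fun d => ?_⟩
  · simp only [LinearEquiv.ofBijective_apply]
    induction x using DirectSum.induction_on with
    | zero => simp only [map_zero]
    | add x y hx hy => simp only [map_add, hx, hy]
    | of d z =>
      rw [← DirectSum.lof_eq_of ℂ, DirectSum.lmap_lof, DirectSum.toModule_lof,
        DirectSum.toModule_lof]
      induction z using TensorProduct.induction_on with
      | zero => simp only [map_zero]
      | add x y hx hy => simp only [map_add, hx, hy]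
      | tmul p y =>
        rw [outerAct_tmul]
        exact hA d (Algebra.lsmul ℂ ℂ _ u) u (hu d u) v p y
  · rw [← LinearMap.range_comp, ← hrT d]
    congr 1
    exact LinearMap.ext fun z => DirectSum.toModule_lof (φ := T) ℂ d z

theorem eq_of_repIso {q : ℂ} (hq : IsGeneric q) (i j : ℕ × Bool)
    (h : RepIso
      (outerAct (Uq (q ^ 2)) (Uq q) (L (q ^ 2) (lowWt q i)) (L q (q ^ (2 * i.1 + 2))))
      (outerAct (Uq (q ^ 2)) (Uq q) (L (q ^ 2) (lowWt q j)) (L q (q ^ (2 * j.1 + 2))))) :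
    i = j := by
  -- An isomorphism puts the weights of `i` above those of `j`, and its inverse the other way round.
  -- Since no positive power of `q` is `1`, both shifts are trivial.
  have key := fun i j => exists_eq_wt_of_repIso hq.sq hq (genericWt_lowWt hq i)
    (genericWt_pos hq (2 * i.1 + 1)) (genericWt_lowWt hq j) (genericWt_pos hq (2 * j.1 + 1))
    (L.low_ne_zero hq i) (L.low_ne_zero_sigma hq i.1) (L.low_ne_zero hq j)
    (L.low_ne_zero_sigma hq j.1)
  obtain ⟨⟨m, hm⟩, n, hn⟩ := key i j h
  obtain ⟨⟨m', hm'⟩, n', hn'⟩ := key j i h.symm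
  have hwt : lowWt q i = lowWt q j := by
    have h1 := (genericWt_lowWt hq i).ne_zero
    rw [hm', mul_assoc, ← pow_add, ← mul_add] at hm
    have h2 : (q ^ 2) ^ (2 * (m' + m)) = 1 := (mul_eq_left₀ h1).1 hm.symm
    have h3 : m' + m = 0 := by
      by_contra h0
      exact hq.sq.pow_ne_one _ (by omega) h2
    obtain rfl : m' = 0 := by omega
    rw [hm', mul_zero, pow_zero, mul_one]
  have hd : i.1 = j.1 := by
    rw [← pow_add] at hn hn'
    have h1 := hq.pow_injective hn
    have h2 := hq.pow_injective hn'
    omega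
  obtain ⟨d, b⟩ := i
  obtain ⟨d', b'⟩ := j
  obtain rfl : d = d' := hd
  -- The second weight gives the degree. Within one degree the two weights over `U_{q²}` differ by
  -- the factor `q^(4d+2)`, which is not `1`.
  have hne : q ^ (1 - 2 * (d : ℤ)) ≠ q ^ (3 + 2 * (d : ℤ)) := fun h => by
    have h1 : (3 + 2 * (d : ℤ)) = (1 - 2 * d) + (2 + 4 * d) := by ring
    rw [h1, zpow_add₀ hq.ne_zero] at h
    exact hq.zpow_ne_one (n := 2 + 4 * d) (by omega)
      ((mul_eq_left₀ (zpow_ne_zero _ hq.ne_zero)).1 h.symm)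
  cases b <;> cases b'
  · rfl
  · exact absurd hwt.symm hne
  · exact absurd hwt hne
  · rfl

end

end QMetaplectic

theorem corollary5p10 (q : ℂ) (hq : IsGeneric q) :
    -- the two actions commute
    (∀ (u : Uq (q ^ 2)) (v : Uq q), Commute (sigmaDelta q hq u) (sigma q hq v)) ∧
    -- the joint decomposition; its `d`-th summand is the `d`-th row of the triangle
    (∃ Φ : (⨁ d : ℕ, (L (q ^ 2) (q ^ (1 - 2 * (d : ℤ))) × L (q ^ 2) (q ^ (3 + 2 * (d : ℤ))))
          ⊗[ℂ] L q (q ^ (2 * d + 2))) ≃ₗ[ℂ] PS,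
      (∀ (u : Uq (q ^ 2)) (v : Uq q) x,
        Φ (DirectSum.lmap (fun d : ℕ => outerAct (Uq (q ^ 2)) (Uq q)
            (L (q ^ 2) (q ^ (1 - 2 * (d : ℤ))) × L (q ^ 2) (q ^ (3 + 2 * (d : ℤ))))
            (L q (q ^ (2 * d + 2))) (u ⊗ₜ v)) x) =
          sigmaDelta q hq u (sigma q hq v (Φ x))) ∧
      ∀ d : ℕ, (LinearMap.range (DirectSum.lof ℂ ℕ (fun d : ℕ =>
            (L (q ^ 2) (q ^ (1 - 2 * (d : ℤ))) × L (q ^ 2) (q ^ (3 + 2 * (d : ℤ))))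
              ⊗[ℂ] L q (q ^ (2 * d + 2))) d)).map Φ.toLinearMap =
          ⨆ k : ℕ, rowEntry q d k) ∧
    -- multiplicity-freeness: the summands are irreducible and pairwise non-isomorphic
    (∀ i : ℕ × Bool, IsIrreducibleRep (outerAct (Uq (q ^ 2)) (Uq q)
        (L (q ^ 2) (lowWt q i)) (L q (q ^ (2 * i.1 + 2))))) ∧
    (∀ i j : ℕ × Bool,
      RepIso
        (outerAct (Uq (q ^ 2)) (Uq q) (L (q ^ 2) (lowWt q i)) (L q (q ^ (2 * i.1 + 2))))
        (outerAct (Uq (q ^ 2)) (Uq q) (L (q ^ 2) (lowWt q j)) (L q (q ^ (2 * j.1 + 2)))) →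
      i = j) ∧
    -- the triangle: its columns
    DirectSum.IsInternal PSdeg ∧
    (∀ d : ℕ, iSupIndep (fun k : Fin (d + 1) => rowEntry q (d - k) k) ∧
      ⨆ k : Fin (d + 1), rowEntry q (d - k) k = PSdeg d) ∧
    -- its arrows
    (∀ d k : ℕ, Set.BijOn (sigma q hq (Uq.e q)) (rowEntry q d k) (rowEntry q d (k + 1))) ∧
    -- its diagonal entries
    (∀ d : ℕ, Disjoint (MonoPlus q d) (MonoMinus q d) ∧
      MonoPlus q d ⊔ MonoMinus q d = Mono q d ∧
      (∃ φ : L (q ^ 2) (q ^ (1 - 2 * (d : ℤ))) ≃ₗ[ℂ] MonoPlus q d,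
        ∀ (u : Uq (q ^ 2)) x, (φ (u • x) : PS) = sigmaDelta q hq u (φ x)) ∧
      ∃ φ : L (q ^ 2) (q ^ (3 + 2 * (d : ℤ))) ≃ₗ[ℂ] MonoMinus q d,
        ∀ (u : Uq (q ^ 2)) x, (φ (u • x) : PS) = sigmaDelta q hq u (φ x)) := by
  exact ⟨commute_sigmaDelta_sigma q hq, exists_decomposition hq,
    fun i => outerAct_isIrreducible hq.sq hq (genericWt_lowWt hq i)
      (genericWt_pos hq (2 * i.1 + 1)) (L.low_ne_zero hq i) (L.low_ne_zero_sigma hq i.1),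
    eq_of_repIso hq, isInternal_PSdeg hq, fun d => ⟨iSupIndep_column hq d, iSup_column hq d⟩,
    fun d k => by rw [sigma_e]; exact bijOn_opE hq d k,
    fun d => ⟨disjoint_MonoPlus_MonoMinus q d, MonoPlus_sup_MonoMinus q d,
      exists_equiv_MonoPlus hq d, exists_equiv_MonoMinus hq d⟩⟩
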